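/- **Theorem 5.3.** Let $k$ be a field, let $n\ge 0$, let $E=k\langle x_1,\dots,x_n\rangle/\langle x_i^2,\;x_ix_j+x_jx_i\rangle$ be the exterior algebra and let $S=k[x_1,\dots,x_n]$ be the commutative polynomial ring, both multigraded by $\mathbb N^n$ with $\deg x_j$ the $j$-th unit vector. Let $E\otimes_k E^{\rm op}$ carry the ordinary (unsigned) product, let it act on $E$ by $(a\otimes b)\cdot m=a\,m\,b$, and let $k$ be the trivial bimodule, on which all $x_j$ act as $0$. (1) For $i\ge 0$ let $$F_i=\bigoplus_{\substack{1\le i_1<\dots<i_r\le n\\ l_1,\dots,l_r\ge 1,\; l_1+\dots+l_r=i}} (E\otimes E^{\rm op})\;e_{i_1}^{(l_1)}\cdots e_{i_r}^{(l_r)},$$ where $e_j^{(0)}:=1$, and for $i\ge 1$ let $\partial:F_i\to F_{i-1}$ be the $E\otimes E^{\rm op}$-linear map with $$\partial\big(e_{i_1}^{(l_1)}\cdots e_{i_r}^{(l_r)}\big)=\sum_{j=1}^r \big(x_{i_j}\otimes 1+(-1)^{i}\,1\otimes x_{i_j}\big)\; e_{i_1}^{(l_1)}\cdots e_{i_j}^{(l_j-1)}\cdots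 e_{i_r}^{(l_r)},\qquad i=l_1+\dots+l_r .$$ Then $(F_\bullet,\partial)$, with the augmentation $F_0=E\otimes E^{\rm op}\to E$, $a\otimes b\mapsto ab$, is a minimal free resolution of $E$ as an $E\otimes E^{\rm op}$-module. It is multigraded, with $\deg e_{i_1}^{(l_1)}\cdots e_{i_r}^{(l_r)}=\deg x_{i_1}^{l_1}\cdots x_{i_r}^{l_r}$; minimal means that $\partial(F_{i+1})\subseteq\mathfrak m F_i$, where $\mathfrak m$ is the kernel of the augmentation $E\otimes E^{\rm op}\to k$. (2) For $A=E$ or $A=S$ let $HH(A,k)$ be the Hochschild homology of $A$ with coefficients in $k$, that is, the homology of $k\otimes_{A\otimes A^{\rm op}}HC^A_\bullet$ with $HC^A_i=A^{\otimes(i+2)}$ and $\partial(a_0\otimes\dots\otimes a_{i+1})=\sum_{j=0}^{i}(-1)^j a_0\otimes\dots\otimes a_ja_{j+1}\otimes\dots\otimes a_{i+1}$, and put $\mathrm{Hilb}(HH(A,k))=\sum_{i,\alpha}\dim_k\big(HH_i(A,k)_\alpha\big)x^\alpha t^i$. Then $$\mathrm{Hilb}(HH(E,k))=\sum_{i,\alpha}\dim_k\Big(\mathrm{Tor}_i^{E\otimes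 E^{\rm op}}(k,E)_\alpha\Big)x^\alpha t^i,$$ where the multigraded Tor is computed by any multigraded free resolution of $E$ over $E\otimes E^{\rm op}$. (3) With $\mathrm{Hilb}(A)=\sum_\alpha \dim_k(A_\alpha)\,x^\alpha t^{|\alpha|}$, where $|\alpha|=\alpha_1+\dots+\alpha_n$, there is the duality $$\mathrm{Hilb}(HH(E,k))=\mathrm{Hilb}(S),\qquad \mathrm{Hilb}(HH(S,k))=\mathrm{Hilb}(E).$$ -/

import Mathlib

open scoped TensorProduct

noncomputable section

namespace HochschildDuality

universe u v w

/-! ### Enveloping algebra and bimodules -/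

section Env

variable (k : Type u) [Field k] (A : Type v) [Ring A] [Algebra k A]

/-- The enveloping algebra `A ⊗ Aᵒᵖ`, with the usual product
`(a ⊗ b) (a' ⊗ b') = a a' ⊗ (b * b')`, the second product being taken in `Aᵒᵖ`. -/
abbrev Env : Type v := A ⊗[k] Aᵐᵒᵖ

/-- `A` as a left module over `A ⊗ Aᵒᵖ`: `(a ⊗ b) • m = a m b`. -/
instance envModuleSelf : Module (Env k A) A := TensorProduct.Algebra.module

variable {k A}

theorem env_tmul_smul (a : A) (b : Aᵐᵒᵖ) (m : A) :
    (a ⊗ₜ[k] b : Env k A) • m = a * m * b.unop := by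
  have h : (a ⊗ₜ[k] b : Env k A) • m = a • b • m := TensorProduct.Algebra.smul_def a b m
  rw [h, MulOpposite.smul_eq_mul_unop, smul_eq_mul, mul_assoc]

/-- The augmentation of `A ⊗ Aᵒᵖ` given by an augmentation `ε` of `A`: `a ⊗ b ↦ ε a * ε b`. -/
def envAug (ε : A →ₐ[k] k) : Env k A →ₐ[k] k :=
  Algebra.TensorProduct.lift ε (AlgHom.fromOpposite ε fun _ _ => Commute.all _ _)
    fun _ _ => Commute.all _ _

end Env

/-! ### Multigradings and Hilbert series

Multidegrees are elements `α : σ →₀ ℕ`; a multigrading is recorded by its family of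
homogeneous components. -/

section Grading

variable {k : Type u} [Field k] {σ : Type*}

/-- Component of multidegree `α` of an algebra generated by elements `x s` of multidegree
`e_s`: the span of all words in the `x s` in which each letter `x s` occurs `α s` times. -/
def algPiece {A : Type v} [Ring A] [Algebra k A] (x : σ → A) (α : σ →₀ ℕ) : Submodule k A :=
  Submodule.span k
    {a | ∃ l : List σ, (l.map fun s => Finsupp.single s 1).sum = α ∧ a = (l.map x).prod}

/-- Component of multidegree `α` of `A ⊗ Aᵒᵖ`. -/
def envPiece {A : Type v} [Ring A] [Algebra k A] (x : σ → A) (α : σ →₀ ℕ) :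
    Submodule k (Env k A) :=
  Submodule.span k {r | ∃ β γ : σ →₀ ℕ, β + γ = α ∧
    ∃ a ∈ algPiece (k := k) x β, ∃ b ∈ algPiece (k := k) x γ, r = a ⊗ₜ[k] MulOpposite.op b}

/-- Component of multidegree `α` of the free module over a multigraded algebra `R` on a basis
`B` whose element `b` has multidegree `deg b`. -/
def freePiece {R : Type v} [Ring R] [Algebra k R] (Rgr : (σ →₀ ℕ) → Submodule k R)
    {B : Type w} (deg : B → σ →₀ ℕ) (α : σ →₀ ℕ) : Submodule k (B →₀ R) :=
  Submodule.span k {f | ∃ b, ∃ γ, γ + deg b = α ∧ ∃ r ∈ Rgr γ, f = Finsupp.single b r}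

/-- The `k`-dimension of a vector space, as an element of `ℕ ∪ {∞}`. -/
def dimK (V : Type*) [AddCommGroup V] [Module k V] : ℕ∞ := Cardinal.toENat (Module.rank k V)

/-- Hilbert series `∑ dim (A_α) x^α t^|α|` of an algebra generated by elements `x s` of
multidegree `e_s`. The exponent of `t` is stored at `none`, the one of `x_s` at `some s`. -/
def hilbAlg (k : Type u) [Field k] {A : Type v} [Ring A] [Algebra k A] (x : σ → A) :
    MvPowerSeries (Option σ) ℕ∞ :=
  fun m => if m none = m.some.degree then dimK (k := k) (algPiece (k := k) x m.some) else 0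

end Grading

/-! ### Tensoring with the residue field, and homology with its multigrading -/

section Residue

variable {k : Type u} [Field k] {R : Type v} [Ring R] [Algebra k R] (ε : R →ₐ[k] k)

/-- The relations `c · r ⊗ m = c ⊗ r · m` defining `k ⊗_R M`, where `k` is a right `R`-module
through the augmentation `ε`. -/
def residueRel (M : Type w) [AddCommGroup M] [Module k M] [Module R M] : Submodule k (k ⊗[k] M) :=
  Submodule.span k {z | ∃ (c : k) (r : R) (m : M), z = (c * ε r) ⊗ₜ[k] m - c ⊗ₜ[k] (r • m)}

/-- The tensor product `k ⊗_R M` of the right `R`-module `k` (through `ε`) and the left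
`R`-module `M`. -/
abbrev ResidueTensor (M : Type w) [AddCommGroup M] [Module k M] [Module R M] : Type (max u w) :=
  (k ⊗[k] M) ⧸ residueRel ε M

variable {M N : Type w} [AddCommGroup M] [Module k M] [Module R M] [IsScalarTower k R M]
  [AddCommGroup N] [Module k N] [Module R N] [IsScalarTower k R N]

/-- The map `k ⊗_R f`. -/
def ResidueTensor.map (f : M →ₗ[R] N) : ResidueTensor ε M →ₗ[k] ResidueTensor ε N :=
  Submodule.mapQ _ _ (LinearMap.lTensor k (f.restrictScalars k)) (by
    rw [residueRel, Submodule.span_le]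
    rintro _ ⟨c, r, m, rfl⟩
    refine Submodule.subset_span ⟨c, r, f m, ?_⟩
    simp)

/-- The component of multidegree `α` of `k ⊗_R M`, with `k` in multidegree `0`: the classes
`1 ⊗ m` for `m` in the component of multidegree `α` of `M`. -/
def ResidueTensor.piece (P : Submodule k M) : Submodule k (ResidueTensor ε M) :=
  P.map ((residueRel ε M).mkQ ∘ₗ TensorProduct.mk k k M 1)

end Residue

section Homology

variable {k : Type u} [Field k] {σ : Type*} {X : ℕ → Type w} [∀ i, AddCommGroup (X i)]
  [∀ i, Module k (X i)]

/-- Cycles of `⋯ → X 2 → X 1 → X 0 → 0`. -/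
def cycles (d : ∀ i, X (i + 1) →ₗ[k] X i) : ∀ i, Submodule k (X i)
  | 0 => ⊤
  | i + 1 => LinearMap.ker (d i)

/-- Homology (cycles modulo boundaries) of `⋯ → X 2 → X 1 → X 0 → 0`. -/
abbrev Homology (d : ∀ i, X (i + 1) →ₗ[k] X i) (i : ℕ) : Type w :=
  cycles d i ⧸ (LinearMap.range (d i)).submoduleOf (cycles d i)

/-- The component of multidegree `α` of the homology: classes of cycles of multidegree `α`. -/
def homologyPiece (d : ∀ i, X (i + 1) →ₗ[k] X i) (gr : ∀ i, (σ →₀ ℕ) → Submodule k (X i))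
    (i : ℕ) (α : σ →₀ ℕ) : Submodule k (Homology d i) :=
  ((gr i α).submoduleOf (cycles d i)).map (Submodule.mkQ _)

/-- Hilbert series `∑ dim (H_i)_α x^α t^i` of the homology of a multigraded complex. -/
def hilbHomology (d : ∀ i, X (i + 1) →ₗ[k] X i) (gr : ∀ i, (σ →₀ ℕ) → Submodule k (X i)) :
    MvPowerSeries (Option σ) ℕ∞ :=
  fun m => dimK (k := k) (homologyPiece d gr (m none) m.some)

/-- Hilbert series `∑ dim (H_i(k ⊗_R X))_α x^α t^i` for a complex `X` of left modules over an
augmented algebra `R`, with a multigrading `gr`. -/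
def hilbResidue {R : Type v} [Ring R] [Algebra k R] (ε : R →ₐ[k] k) [∀ i, Module R (X i)]
    [∀ i, IsScalarTower k R (X i)] (d : ∀ i, X (i + 1) →ₗ[R] X i)
    (gr : ∀ i, (σ →₀ ℕ) → Submodule k (X i)) : MvPowerSeries (Option σ) ℕ∞ :=
  hilbHomology (X := fun i => ResidueTensor ε (X i)) (fun i => ResidueTensor.map ε (d i))
    (fun i α => ResidueTensor.piece ε (gr i α))

end Homology

/-! ### Multigraded free resolutions -/

section Resolution

variable {k : Type u} [Field k] {σ : Type*} {R : Type v} [Ring R] [Algebra k R]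
  {N : Type w} [AddCommGroup N] [Module k N] [Module R N]

/-- `⋯ → R^(B 1) → R^(B 0) → N → 0` is a multigraded free resolution of `N`: it is exact, the
basis element `b ∈ B i` is homogeneous of multidegree `deg i b`, and all maps preserve
multidegrees. -/
structure IsMultigradedFreeResolution (Rgr : (σ →₀ ℕ) → Submodule k R)
    (Ngr : (σ →₀ ℕ) → Submodule k N) {B : ℕ → Type*} (deg : ∀ i, B i → σ →₀ ℕ)
    (d : ∀ i, (B (i + 1) →₀ R) →ₗ[R] (B i →₀ R)) (aug : (B 0 →₀ R) →ₗ[R] N) : Prop where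
  aug_surjective : Function.Surjective aug
  exact_zero : Function.Exact (d 0) aug
  exact_succ : ∀ i, Function.Exact (d (i + 1)) (d i)
  aug_homogeneous : ∀ b, aug (Finsupp.single b 1) ∈ Ngr (deg 0 b)
  d_homogeneous : ∀ i b, d i (Finsupp.single b 1) ∈ freePiece Rgr (deg i) (deg (i + 1) b)

/-- Minimality of a complex of free modules over an algebra with augmentation `ε`: the image of
every differential is contained in `(ker ε) F`, i.e. all coefficients lie in `ker ε`. -/
def IsMinimal (ε : R →ₐ[k] k) {B : ℕ → Type*} (d : ∀ i, (B (i + 1) →₀ R) →ₗ[R] (B i →₀ R)) :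
    Prop :=
  ∀ i y b, ε (d i y b) = 0

/-- The series `∑ dim Tor_i^R(k, N)_α x^α t^i` computed from a multigraded free resolution
`⋯ → R^(B 1) → R^(B 0) → N → 0`, i.e. the Hilbert series of the homology of `k ⊗_R R^(B i)`. -/
def hilbTor (ε : R →ₐ[k] k) (Rgr : (σ →₀ ℕ) → Submodule k R) {B : ℕ → Type*}
    (deg : ∀ i, B i → σ →₀ ℕ) (d : ∀ i, (B (i + 1) →₀ R) →ₗ[R] (B i →₀ R)) :
    MvPowerSeries (Option σ) ℕ∞ :=
  hilbResidue (X := fun i => B i →₀ R) ε d fun i => freePiece Rgr (deg i)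

end Resolution

/-! ### The acyclic Hochschild complex -/

section Hochschild

/-- An action of an algebra `C` on `A`, applied to the `j`-th factor of `A ⊗ ⋯ ⊗ A`. -/
def actAt {k : Type u} [Field k] {A : Type v} [AddCommGroup A] [Module k A] {C : Type w} [Ring C]
    [Algebra k C] {m : ℕ} (j : Fin m) (φ : C →ₐ[k] Module.End k A) :
    C →ₐ[k] Module.End k (⨂[k] _ : Fin m, A) :=
  AlgHom.ofLinearMap
    ((PiTensorProduct.mapMultilinear k (fun _ : Fin m => A) (fun _ => A)).toLinearMap
      (fun _ => LinearMap.id) j ∘ₗ φ.toLinearMap)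
    (by
      refine PiTensorProduct.ext (MultilinearMap.ext fun a => ?_)
      simp only [LinearMap.comp_apply, AlgHom.toLinearMap_apply, map_one,
        MultilinearMap.toLinearMap_apply, PiTensorProduct.mapMultilinear_apply,
        LinearMap.compMultilinearMap_apply, PiTensorProduct.map_tprod, Module.End.one_apply]
      congr 1
      funext l
      by_cases h : l = j
      · subst h; simp
      · simp [Function.update_of_ne h])
    (by
      intro x y
      refine PiTensorProduct.ext (MultilinearMap.ext fun a => ?_)
      simp only [LinearMap.comp_apply, AlgHom.toLinearMap_apply, map_mul,
        MultilinearMap.toLinearMap_apply, PiTensorProduct.mapMultilinear_apply,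
        LinearMap.compMultilinearMap_apply, PiTensorProduct.map_tprod, Module.End.mul_apply]
      congr 1
      funext l
      by_cases h : l = j
      · subst h; simp
      · simp [Function.update_of_ne h])

theorem actAt_tprod {k : Type u} [Field k] {A : Type v} [AddCommGroup A] [Module k A] {C : Type w}
    [Ring C] [Algebra k C] {m : ℕ} (j : Fin m) (φ : C →ₐ[k] Module.End k A) (c : C)
    (a : Fin m → A) :
    actAt j φ c (PiTensorProduct.tprod k a)
      = PiTensorProduct.tprod k (Function.update a j (φ c (a j))) := by
  have h : actAt j φ c (PiTensorProduct.tprod k a) = PiTensorProduct.map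
      (Function.update (fun _ => LinearMap.id) j (φ c)) (PiTensorProduct.tprod k a) := rfl
  rw [h, PiTensorProduct.map_tprod]
  congr 1
  funext l
  by_cases h : l = j
  · subst h; simp
  · simp [Function.update_of_ne h]

variable (k : Type u) [Field k] (A : Type v) [Ring A] [Algebra k A]

/-- `A ⊗ Aᵒᵖ` acts on `A^{⊗ (i + 2)}` by left multiplication on the first factor and right
multiplication on the last one. -/
def bimoduleAct (i : ℕ) : Env k A →ₐ[k] Module.End k (⨂[k] _ : Fin (i + 2), A) :=
  Algebra.TensorProduct.lift
    (actAt (0 : Fin (i + 2)) (Algebra.lsmul k k A : A →ₐ[k] Module.End k A))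
    (actAt (Fin.last (i + 1)) (Algebra.lsmul k k A : Aᵐᵒᵖ →ₐ[k] Module.End k A)) (by
      intro x y
      refine PiTensorProduct.ext (MultilinearMap.ext fun a => ?_)
      have h : (0 : Fin (i + 2)) ≠ Fin.last (i + 1) := (Fin.last_pos).ne
      simp only [LinearMap.compMultilinearMap_apply, Module.End.mul_apply, actAt_tprod,
        Function.update_of_ne h, Function.update_of_ne h.symm, Function.update_comm h])

/-- The `i`-th term `A^{⊗ (i + 2)}` of the acyclic Hochschild complex. -/
def HC (i : ℕ) : Type (max u v) := ⨂[k] _ : Fin (i + 2), A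

instance (i : ℕ) : AddCommGroup (HC k A i) :=
  inferInstanceAs (AddCommGroup (⨂[k] _ : Fin (i + 2), A))

instance (i : ℕ) : Module k (HC k A i) :=
  inferInstanceAs (Module k (⨂[k] _ : Fin (i + 2), A))

variable {A}

/-- The pure tensor `a 0 ⊗ ⋯ ⊗ a (i + 1)`. -/
def HC.tprod (i : ℕ) : MultilinearMap k (fun _ : Fin (i + 2) => A) (HC k A i) :=
  PiTensorProduct.tprod k

variable {k}

theorem HC.hom_ext {i : ℕ} {V : Type*} [AddCommGroup V] [Module k V] {f g : HC k A i →ₗ[k] V}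
    (h : ∀ a, f (HC.tprod k i a) = g (HC.tprod k i a)) : f = g :=
  PiTensorProduct.ext (MultilinearMap.ext h)

variable (k A)

/-- The action of `A ⊗ Aᵒᵖ` on `A^{⊗ (i + 2)}`. -/
def HC.act (i : ℕ) : Env k A →ₐ[k] Module.End k (HC k A i) := bimoduleAct k A i

instance (i : ℕ) : Module (Env k A) (HC k A i) :=
  Module.compHom (HC k A i) (HC.act k A i).toRingHom

variable {k A}

theorem HC.smul_def {i : ℕ} (r : Env k A) (m : HC k A i) : r • m = HC.act k A i r m := rfl

instance (i : ℕ) : IsScalarTower k (Env k A) (HC k A i) where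
  smul_assoc c r m := by simp only [HC.smul_def, map_smul, LinearMap.smul_apply]

/-- `(μ ⊗ γ) • (a₀ ⊗ ⋯ ⊗ aₗ) = (μ a₀) ⊗ a₁ ⊗ ⋯ ⊗ (aₗ γ)`. -/
theorem HC.tmul_smul_tprod {i : ℕ} (x : A) (y : Aᵐᵒᵖ) (a : Fin (i + 2) → A) :
    (x ⊗ₜ[k] y : Env k A) • HC.tprod k i a
      = HC.tprod k i fun l =>
        (if l = 0 then x else 1) * a l * (if l = Fin.last (i + 1) then y.unop else 1) := by
  have h : (0 : Fin (i + 2)) ≠ Fin.last (i + 1) := (Fin.last_pos).ne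
  change actAt _ _ x (actAt _ _ y (PiTensorProduct.tprod k a)) = PiTensorProduct.tprod k _
  rw [actAt_tprod, actAt_tprod, Function.update_of_ne h]
  congr 1
  funext l
  by_cases h0 : l = 0
  · subst h0; simp [h]
  · by_cases h1 : l = Fin.last (i + 1)
    · subst h1; simp [h.symm]
    · simp [h0, h1]

/-- Multiplying two neighbouring entries depends linearly on each entry. -/
theorem contractNth_update {m : ℕ} (j : Fin m) (a : Fin (m + 1) → A) (p : Fin (m + 1)) :
    ∃ (q : Fin m) (L : A →ₗ[k] A), ∀ x,
      Fin.contractNth j.castSucc (· * ·) (Function.update a p x)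
        = Function.update (Fin.contractNth j.castSucc (· * ·) a) q (L x) := by
  obtain ⟨p, hp⟩ := p
  obtain ⟨j, hj⟩ := j
  rcases lt_trichotomy p j with h | h | h
  · refine ⟨⟨p, by omega⟩, LinearMap.id, fun x => ?_⟩
    funext ⟨l, hl⟩
    simp only [Fin.contractNth, Function.update_apply, Fin.ext_iff, Fin.val_castSucc, Fin.val_succ,
      LinearMap.id_apply]
    split_ifs <;> first | rfl | omega
  · refine ⟨⟨j, hj⟩, LinearMap.mulRight k (a ⟨j + 1, by omega⟩), fun x => ?_⟩
    funext ⟨l, hl⟩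
    simp only [Fin.contractNth, Function.update_apply, Fin.ext_iff, Fin.val_castSucc, Fin.val_succ,
      LinearMap.mulRight_apply]
    split_ifs <;> first | rfl | omega | (subst_vars; rfl)
  · by_cases h' : p = j + 1
    · refine ⟨⟨j, hj⟩, LinearMap.mulLeft k (a ⟨j, by omega⟩), fun x => ?_⟩
      funext ⟨l, hl⟩
      simp only [Fin.contractNth, Function.update_apply, Fin.ext_iff, Fin.val_castSucc,
        Fin.val_succ, LinearMap.mulLeft_apply]
      split_ifs <;> first | rfl | omega | (subst_vars; rfl)
    · refine ⟨⟨p - 1, by omega⟩, LinearMap.id, fun x => ?_⟩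
      funext ⟨l, hl⟩
      simp only [Fin.contractNth, Function.update_apply, Fin.ext_iff, Fin.val_castSucc,
        Fin.val_succ, LinearMap.id_apply]
      split_ifs <;> first | rfl | omega

/-- The multilinear map `a ↦ a 0 ⊗ ⋯ ⊗ a j * a (j + 1) ⊗ ⋯ ⊗ a (i + 2)`. -/
def HC.face (i : ℕ) (j : Fin (i + 2)) : MultilinearMap k (fun _ : Fin (i + 3) => A) (HC k A i) where
  toFun a := HC.tprod k i (Fin.contractNth j.castSucc (· * ·) a)
  map_update_add' {inst} a p x y := by
    rw [Subsingleton.elim inst (instDecidableEqFin _)]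
    obtain ⟨q, L, h⟩ := contractNth_update (k := k) j a p
    simp only [h, map_add, MultilinearMap.map_update_add]
  map_update_smul' {inst} a p c x := by
    rw [Subsingleton.elim inst (instDecidableEqFin _)]
    obtain ⟨q, L, h⟩ := contractNth_update (k := k) j a p
    simp only [h, map_smul, MultilinearMap.map_update_smul]

/-- The Hochschild differential as a `k`-linear map. -/
def HC.dLin (i : ℕ) : HC k A (i + 1) →ₗ[k] HC k A i :=
  PiTensorProduct.lift (∑ j : Fin (i + 2), (-1 : k) ^ (j : ℕ) • HC.face i j)

theorem HC.dLin_tprod (i : ℕ) (a : Fin (i + 3) → A) :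
    HC.dLin i (HC.tprod k (i + 1) a) = ∑ j : Fin (i + 2), (-1 : k) ^ (j : ℕ) •
      HC.tprod k i (Fin.contractNth j.castSucc (· * ·) a) := by
  have h : HC.dLin i (HC.tprod k (i + 1) a)
      = (∑ j : Fin (i + 2), (-1 : k) ^ (j : ℕ) • HC.face i j) a :=
    PiTensorProduct.lift.tprod a
  rw [h, sum_apply]
  rfl

theorem HC.dLin_smul (i : ℕ) (r : Env k A) (m : HC k A (i + 1)) :
    HC.dLin i (r • m) = r • HC.dLin i m := by
  induction r using TensorProduct.induction_on with
  | zero =>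
    rw [zero_smul (Env k A) m, zero_smul (Env k A) (HC.dLin i m), map_zero]
  | add r s hr hs =>
    rw [add_smul (r : Env k A) s m, add_smul (r : Env k A) s (HC.dLin i m), map_add, hr, hs]
  | tmul x y =>
    suffices h : HC.dLin i ∘ₗ HC.act k A (i + 1) (x ⊗ₜ[k] y)
        = HC.act k A i (x ⊗ₜ[k] y) ∘ₗ HC.dLin i from LinearMap.congr_fun h m
    refine HC.hom_ext fun a => ?_
    simp only [LinearMap.comp_apply, ← HC.smul_def, HC.tmul_smul_tprod, HC.dLin_tprod]
    rw [HC.smul_def, map_sum]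
    refine Finset.sum_congr rfl fun j _ => ?_
    rw [map_smul, ← HC.smul_def, HC.tmul_smul_tprod]
    congr 2
    obtain ⟨j, hj⟩ := j
    funext ⟨l, hl⟩
    simp only [Fin.contractNth, Fin.ext_iff, Fin.val_castSucc, Fin.val_succ, Fin.val_zero,
      Fin.val_last]
    split_ifs <;> first | contradiction | omega | simp [mul_assoc]

variable (k A)

/-- The differential
`a₀ ⊗ ⋯ ⊗ a_{i+2} ↦ ∑_{j=0}^{i+1} (-1)^j a₀ ⊗ ⋯ ⊗ a_j a_{j+1} ⊗ ⋯ ⊗ a_{i+2}`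
of the acyclic Hochschild complex (see `HC.dLin_tprod`). -/
def HC.d (i : ℕ) : HC k A (i + 1) →ₗ[Env k A] HC k A i where
  toFun := HC.dLin i
  map_add' := map_add _
  map_smul' := HC.dLin_smul i

variable {k A}

/-- Component of multidegree `α` of `A^{⊗ (i + 2)}`. -/
def HC.piece {σ : Type*} (x : σ → A) (i : ℕ) (α : σ →₀ ℕ) : Submodule k (HC k A i) :=
  Submodule.span k {z | ∃ β : Fin (i + 2) → σ →₀ ℕ, ∑ l, β l = α ∧
    ∃ a : Fin (i + 2) → A, (∀ l, a l ∈ algPiece (k := k) x (β l)) ∧ z = HC.tprod k i a}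

/-- Hilbert series `∑ dim HH_i(A, k)_α x^α t^i` of the Hochschild homology of `A` with
coefficients in `k`, i.e. of the homology of `k ⊗_{A ⊗ Aᵒᵖ} HC`, for an algebra `A` with
augmentation `ε` and generators `x s` of multidegree `e_s`. -/
def hilbHH {σ : Type*} (ε : A →ₐ[k] k) (x : σ → A) : MvPowerSeries (Option σ) ℕ∞ :=
  hilbResidue (envAug ε) (HC.d k A) (HC.piece x)

end Hochschild

/-! ### The exterior algebra and its divided power complex -/

section Cartan

variable (k : Type u) [Field k] (n : ℕ)

/-- The exterior algebra on `n` generators over `k`. -/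
abbrev ExtAlg : Type u := ExteriorAlgebra k (Fin n → k)

/-- The generator `x_j` of the exterior algebra. -/
def ExtAlg.x (j : Fin n) : ExtAlg k n := ExteriorAlgebra.ι k (Pi.single j 1)

/-- The augmentation of the exterior algebra, `x_j ↦ 0`. -/
def ExtAlg.aug : ExtAlg k n →ₐ[k] k := ExteriorAlgebra.algebraMapInv

/-- The augmentation of the polynomial ring, `X j ↦ 0`. -/
def polyAug : MvPolynomial (Fin n) k →ₐ[k] k := MvPolynomial.aeval 0

/-- The basis in homological degree `i`: the symbols `e_1^{(l_1)} ⋯ e_n^{(l_n)}` with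
`l_1 + ⋯ + l_n = i`, where `e_j^{(0)}` is omitted. -/
abbrev CartanBasis (n i : ℕ) : Type := {l : Fin n →₀ ℕ // l.degree = i}

/-- The symbol with `e_j^{(l_j)}` replaced by `e_j^{(l_j - 1)}`. -/
def CartanBasis.lower {n i : ℕ} (l : CartanBasis n (i + 1)) (j : Fin n) (h : l.1 j ≠ 0) :
    CartanBasis n i :=
  ⟨l.1 - Finsupp.single j 1, by
    have h1 : Finsupp.single j 1 ≤ l.1 := by
      rw [Finsupp.single_le_iff]; omega
    have h2 := congrArg Finsupp.degree (tsub_add_cancel_of_le h1)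
    rw [map_add, Finsupp.degree_single, l.2] at h2
    omega⟩

/-- The differential
`e^{(l)} ↦ ∑_{j, l_j > 0} (x_j ⊗ 1 + (-1)^{i+1} 1 ⊗ x_j) e_1^{(l_1)} ⋯ e_j^{(l_j - 1)} ⋯ e_n^{(l_n)}`
from homological degree `i + 1` to `i`. -/
def cartanD (i : ℕ) :
    (CartanBasis n (i + 1) →₀ Env k (ExtAlg k n)) →ₗ[Env k (ExtAlg k n)]
      (CartanBasis n i →₀ Env k (ExtAlg k n)) :=
  Finsupp.linearCombination (Env k (ExtAlg k n)) fun l => ∑ j : Fin n,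
    if h : l.1 j ≠ 0 then
      Finsupp.single (l.lower j h)
        (ExtAlg.x k n j ⊗ₜ[k] 1 + (-1 : k) ^ (i + 1) • 1 ⊗ₜ[k] MulOpposite.op (ExtAlg.x k n j))
    else 0

/-- The augmentation `F_0 = E ⊗ Eᵒᵖ → E`, `(a ⊗ b) e^{(0)} ↦ a b`. -/
def cartanAug : (CartanBasis n 0 →₀ Env k (ExtAlg k n)) →ₗ[Env k (ExtAlg k n)] ExtAlg k n :=
  Finsupp.linearCombination (Env k (ExtAlg k n)) fun _ => (1 : ExtAlg k n)

end Cartan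

end HochschildDuality

end

open HochschildDuality

/-!
For any augmented algebra `A` with a homogeneous basis, the acyclic Hochschild complex is a
multigraded free resolution of `A` over `A ⊗ Aᵒᵖ`: `a ↦ 1 ⊗ a` is a contracting homotopy. By the
comparison theorem `HH(A, k)` is therefore `Tor(k, A)`, computed by any multigraded free resolution
of `A`. For the exterior algebra the divided power complex, and for the polynomial ring the Koszul
complex on the `X_j ⊗ 1 - 1 ⊗ X_j`, is such a resolution. In both cases every variable `x_m` has a
homotopy `h_m` (contraction, resp. divided difference) for which `d h_m + h_m d` is diagonal in the
basis and the identity on the basis elements involving `x_m`; correcting a cycle by these one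
variable at a time turns it into a boundary. A generator of homological degree `i` has total degree
`i`, so both resolutions are minimal and `Tor` counts their generators: monomials over the exterior
algebra, squarefree monomials over the polynomial ring.
-/

noncomputable section

namespace HochschildDuality

/-! ### Chain maps, homotopies and Hilbert series of homology -/

section Complex

variable {R : Type*} [Ring R] {X Y : ℕ → Type*} [∀ i, AddCommGroup (X i)] [∀ i, Module R (X i)]
  [∀ i, AddCommGroup (Y i)] [∀ i, Module R (Y i)]

/-- The maps `f i` form a chain map between complexes indexed by `ℕ`, each complex being given by
its sequence of differentials. -/
def IsChainMap (dX : ∀ i, X (i + 1) →ₗ[R] X i) (dY : ∀ i, Y (i + 1) →ₗ[R] Y i)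
    (f : ∀ i, X i →ₗ[R] Y i) : Prop :=
  ∀ i, dY i ∘ₗ f (i + 1) = f i ∘ₗ dX i

theorem IsChainMap.comp {Z : ℕ → Type*} [∀ i, AddCommGroup (Z i)] [∀ i, Module R (Z i)]
    {dX : ∀ i, X (i + 1) →ₗ[R] X i} {dY : ∀ i, Y (i + 1) →ₗ[R] Y i}
    {dZ : ∀ i, Z (i + 1) →ₗ[R] Z i} {g : ∀ i, Y i →ₗ[R] Z i} {f : ∀ i, X i →ₗ[R] Y i}
    (hg : IsChainMap dY dZ g) (hf : IsChainMap dX dY f) :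
    IsChainMap dX dZ fun i => g i ∘ₗ f i := fun i => by
  rw [← LinearMap.comp_assoc, hg, LinearMap.comp_assoc, hf, LinearMap.comp_assoc]

/-- The maps `s i` form a chain homotopy from the identity to the endomorphism `g`: the identities
`g - 1 = d s + s d`, with `d = 0` on the term of index `0`. -/
structure IsHomotopyFromId (d : ∀ i, X (i + 1) →ₗ[R] X i) (g : ∀ i, X i →ₗ[R] X i)
    (s : ∀ i, X i →ₗ[R] X (i + 1)) : Prop where
  zero : g 0 - LinearMap.id = d 0 ∘ₗ s 0
  succ : ∀ i, g (i + 1) - LinearMap.id = d (i + 1) ∘ₗ s (i + 1) + s i ∘ₗ d i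

end Complex

section Homology

variable {k : Type*} [Field k] {σ : Type*}

theorem dimK_congr {V W : Type*} [AddCommGroup V] [Module k V] [AddCommGroup W] [Module k W]
    (e : V ≃ₗ[k] W) : dimK (k := k) V = dimK (k := k) W := by
  simpa only [dimK, Cardinal.toENat_lift] using congrArg Cardinal.toENat e.lift_rank_eq

variable {X Y : ℕ → Type*} [∀ i, AddCommGroup (X i)] [∀ i, Module k (X i)]
  [∀ i, AddCommGroup (Y i)] [∀ i, Module k (Y i)]
  {dX : ∀ i, X (i + 1) →ₗ[k] X i} {dY : ∀ i, Y (i + 1) →ₗ[k] Y i}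

theorem IsChainMap.mapsTo_cycles {f : ∀ i, X i →ₗ[k] Y i} (hf : IsChainMap dX dY f) :
    ∀ i, Set.MapsTo (f i) (cycles dX i) (cycles dY i)
  | 0 => fun _ _ => Submodule.mem_top
  | i + 1 => fun x (hx : dX i x = 0) => by
    change (dY i ∘ₗ f (i + 1)) x = 0
    rw [hf, LinearMap.comp_apply, hx, map_zero]

theorem IsHomotopyFromId.sub_mem_range {g : ∀ i, X i →ₗ[k] X i} {s : ∀ i, X i →ₗ[k] X (i + 1)}
    (hs : IsHomotopyFromId dX g s) :
    ∀ i, ∀ x ∈ cycles dX i, g i x - x ∈ LinearMap.range (dX i)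
  | 0, x, _ => ⟨s 0 x, (LinearMap.congr_fun hs.zero x).symm⟩
  | i + 1, x, (hx : dX i x = 0) => ⟨s (i + 1) x, by
    simpa [hx] using (LinearMap.congr_fun (hs.succ i) x).symm⟩

/-- The map induced on homology by a chain map. -/
def homologyMap {f : ∀ i, X i →ₗ[k] Y i} (hf : IsChainMap dX dY f) (i : ℕ) :
    Homology dX i →ₗ[k] Homology dY i :=
  Submodule.mapQ _ _ ((f i).restrict (hf.mapsTo_cycles i)) (by
    rintro ⟨_, _⟩ ⟨y, rfl⟩
    exact ⟨f (i + 1) y, LinearMap.congr_fun (hf i) y⟩)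

theorem homologyMap_mk {f : ∀ i, X i →ₗ[k] Y i} (hf : IsChainMap dX dY f) (i : ℕ)
    (x : cycles dX i) :
    homologyMap hf i (Submodule.Quotient.mk x)
      = Submodule.Quotient.mk ⟨f i x, hf.mapsTo_cycles i x.2⟩ := rfl

theorem homologyMap_mapsTo_piece {f : ∀ i, X i →ₗ[k] Y i} (hf : IsChainMap dX dY f)
    {grX : ∀ i, (σ →₀ ℕ) → Submodule k (X i)} {grY : ∀ i, (σ →₀ ℕ) → Submodule k (Y i)}
    (hgr : ∀ i α, Set.MapsTo (f i) (grX i α) (grY i α)) (i : ℕ) (α : σ →₀ ℕ) :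
    Set.MapsTo (homologyMap hf i) (homologyPiece dX grX i α) (homologyPiece dY grY i α) := by
  rintro _ ⟨x, hx, rfl⟩
  exact ⟨⟨f i x, hf.mapsTo_cycles i x.2⟩, hgr i α hx, rfl⟩

theorem homologyMap_homologyMap {f : ∀ i, X i →ₗ[k] Y i} {g : ∀ i, Y i →ₗ[k] X i}
    {s : ∀ i, X i →ₗ[k] X (i + 1)} (hf : IsChainMap dX dY f) (hg : IsChainMap dY dX g)
    (hs : IsHomotopyFromId dX (fun i => g i ∘ₗ f i) s) (i : ℕ) (z : Homology dX i) :
    homologyMap hg i (homologyMap hf i z) = z := by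
  obtain ⟨x, rfl⟩ := Submodule.Quotient.mk_surjective _ z
  rw [homologyMap_mk, homologyMap_mk, Submodule.Quotient.eq]
  exact hs.sub_mem_range i x x.2

theorem hilbHomology_eq_of_homotopyEquiv {f : ∀ i, X i →ₗ[k] Y i} {g : ∀ i, Y i →ₗ[k] X i}
    {s : ∀ i, X i →ₗ[k] X (i + 1)} {t : ∀ i, Y i →ₗ[k] Y (i + 1)}
    (hf : IsChainMap dX dY f) (hg : IsChainMap dY dX g)
    (hs : IsHomotopyFromId dX (fun i => g i ∘ₗ f i) s)
    (ht : IsHomotopyFromId dY (fun i => f i ∘ₗ g i) t)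
    {grX : ∀ i, (σ →₀ ℕ) → Submodule k (X i)} {grY : ∀ i, (σ →₀ ℕ) → Submodule k (Y i)}
    (hfgr : ∀ i α, Set.MapsTo (f i) (grX i α) (grY i α))
    (hggr : ∀ i α, Set.MapsTo (g i) (grY i α) (grX i α)) :
    hilbHomology dX grX = hilbHomology dY grY := by
  funext m
  exact dimK_congr (LinearEquiv.ofLinearMap
    ((homologyMap hf _).restrict (homologyMap_mapsTo_piece hf hfgr _ _))
    ((homologyMap hg _).restrict (homologyMap_mapsTo_piece hg hggr _ _))
    (LinearMap.ext fun z => Subtype.ext (homologyMap_homologyMap hg hf ht _ z.1))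
    (LinearMap.ext fun z => Subtype.ext (homologyMap_homologyMap hf hg hs _ z.1)))

theorem dimK_homologyPiece_of_eq_zero (hd : ∀ i, dX i = 0)
    (gr : ∀ i, (σ →₀ ℕ) → Submodule k (X i)) (i : ℕ) (α : σ →₀ ℕ) :
    dimK (k := k) (homologyPiece dX gr i α) = dimK (k := k) (gr i α) := by
  have hcycles : ∀ x, x ∈ cycles dX i := by
    cases i with
    | zero => exact fun _ => Submodule.mem_top
    | succ i => exact fun x => LinearMap.congr_fun (hd i) x
  let q : X i →ₗ[k] Homology dX i := Submodule.mkQ _ ∘ₗ LinearMap.id.codRestrict _ hcycles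
  have hq : Function.Injective q := (injective_iff_map_eq_zero q).2 fun x hx => by
    obtain ⟨y, hy⟩ := (Submodule.Quotient.mk_eq_zero _).1 hx
    change dX i y = x at hy
    rw [← hy, hd, LinearMap.zero_apply]
  have hpiece : (gr i α).map q = homologyPiece dX gr i α := by
    refine le_antisymm ?_ ?_
    · rintro _ ⟨x, hx, rfl⟩
      exact ⟨⟨x, hcycles x⟩, hx, rfl⟩
    · rintro _ ⟨x, hx, rfl⟩
      exact ⟨x.1, hx, rfl⟩
  rw [← hpiece]
  exact dimK_congr (Submodule.equivMapOfInjective q hq _).symm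

end Homology

/-! ### Tensoring with the residue field -/

section Residue

variable {k : Type*} [Field k] {R : Type*} [Ring R] [Algebra k R] (ε : R →ₐ[k] k)

section

variable {M : Type*} [AddCommGroup M] [Module k M] [Module R M]

/-- The class `1 ⊗ m` in `k ⊗_R M`, as a linear map in `m`. -/
def residueMk : M →ₗ[k] ResidueTensor ε M :=
  (residueRel ε M).mkQ ∘ₗ TensorProduct.mk k k M 1

theorem residueMk_surjective : Function.Surjective (residueMk ε (M := M)) :=
  (Submodule.mkQ_surjective _).comp (TensorProduct.lid k M).symm.surjective

theorem residueMk_smul (r : R) (m : M) : residueMk ε (r • m) = ε r • residueMk ε m := by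
  rw [← map_smul]
  have hrel : (1 : k) ⊗ₜ[k] (ε r • m) - 1 ⊗ₜ[k] (r • m) ∈ residueRel ε M :=
    Submodule.subset_span ⟨1, r, m, by
      rw [one_mul, TensorProduct.tmul_smul, TensorProduct.smul_tmul', smul_eq_mul, mul_one]⟩
  exact ((Submodule.Quotient.eq _).2 hrel).symm

variable {ε} in
theorem residueTensor_hom_ext {V : Type*} [AddCommGroup V] [Module k V]
    {f g : ResidueTensor ε M →ₗ[k] V} (h : ∀ m, f (residueMk ε m) = g (residueMk ε m)) : f = g :=
  LinearMap.ext ((residueMk_surjective ε).forall.2 h)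

end

variable {M N : Type*} [AddCommGroup M] [Module k M] [Module R M] [IsScalarTower k R M]
  [AddCommGroup N] [Module k N] [Module R N] [IsScalarTower k R N]

/-- The map `k ⊗_R f`. It agrees with `ResidueTensor.map`, except that `M` and `N` may live in
different universes. -/
def residueMap (f : M →ₗ[R] N) : ResidueTensor ε M →ₗ[k] ResidueTensor ε N :=
  Submodule.mapQ _ _ (LinearMap.lTensor k (f.restrictScalars k)) (by
    rw [residueRel, Submodule.span_le]
    rintro _ ⟨c, r, m, rfl⟩
    refine Submodule.subset_span ⟨c, r, f m, ?_⟩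
    simp)

theorem residueMap_comp {L : Type*} [AddCommGroup L] [Module k L] [Module R L]
    [IsScalarTower k R L] (g : N →ₗ[R] L) (f : M →ₗ[R] N) :
    residueMap ε (g ∘ₗ f) = residueMap ε g ∘ₗ residueMap ε f :=
  residueTensor_hom_ext fun _ => rfl

theorem residueMap_add (f g : M →ₗ[R] N) :
    residueMap ε (f + g) = residueMap ε f + residueMap ε g :=
  residueTensor_hom_ext fun m => map_add (residueMk ε) (f m) (g m)

theorem residueMap_sub_id (g : M →ₗ[R] M) :
    residueMap ε (g - LinearMap.id) = residueMap ε g - LinearMap.id :=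
  residueTensor_hom_ext fun m => map_sub (residueMk ε) (g m) m

theorem residueMap_mapsTo_piece {f : M →ₗ[R] N} {p : Submodule k M} {q : Submodule k N}
    (hf : Set.MapsTo f p q) :
    Set.MapsTo (residueMap ε f) (ResidueTensor.piece ε p) (ResidueTensor.piece ε q) := by
  rintro _ ⟨m, hm, rfl⟩
  exact ⟨f m, hf hm, rfl⟩

end Residue

section ResidueInvariance

universe w w'

variable {k : Type*} [Field k] {R : Type*} [Ring R] [Algebra k R] (ε : R →ₐ[k] k) {σ : Type*}
  {P : ℕ → Type w} [∀ i, AddCommGroup (P i)] [∀ i, Module k (P i)] [∀ i, Module R (P i)]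
  [∀ i, IsScalarTower k R (P i)]
  {Q : ℕ → Type w'} [∀ i, AddCommGroup (Q i)] [∀ i, Module k (Q i)] [∀ i, Module R (Q i)]
  [∀ i, IsScalarTower k R (Q i)]
  {dP : ∀ i, P (i + 1) →ₗ[R] P i} {dQ : ∀ i, Q (i + 1) →ₗ[R] Q i}

theorem IsChainMap.residueMap {f : ∀ i, P i →ₗ[R] Q i} (hf : IsChainMap dP dQ f) :
    IsChainMap (X := fun i => ResidueTensor ε (P i)) (Y := fun i => ResidueTensor ε (Q i))
      (fun i => ResidueTensor.map ε (dP i)) (fun i => ResidueTensor.map ε (dQ i))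
      fun i => residueMap ε (f i) := fun i => by
  change HochschildDuality.residueMap ε (dQ i) ∘ₗ HochschildDuality.residueMap ε (f (i + 1)) =
    HochschildDuality.residueMap ε (f i) ∘ₗ HochschildDuality.residueMap ε (dP i)
  rw [← residueMap_comp, ← residueMap_comp, hf]

theorem IsHomotopyFromId.residueMap {g : ∀ i, P i →ₗ[R] P i} {s : ∀ i, P i →ₗ[R] P (i + 1)}
    (hs : IsHomotopyFromId dP g s) :
    IsHomotopyFromId (X := fun i => ResidueTensor ε (P i))
      (fun i => ResidueTensor.map ε (dP i)) (fun i => residueMap ε (g i))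
      fun i => residueMap ε (s i) where
  zero := by
    rw [← residueMap_sub_id, hs.zero, residueMap_comp]
    rfl
  succ i := by
    rw [← residueMap_sub_id, hs.succ, residueMap_add, residueMap_comp, residueMap_comp]
    rfl

theorem hilbResidue_eq_of_homotopyEquiv {f : ∀ i, P i →ₗ[R] Q i} {g : ∀ i, Q i →ₗ[R] P i}
    {s : ∀ i, P i →ₗ[R] P (i + 1)} {t : ∀ i, Q i →ₗ[R] Q (i + 1)}
    (hf : IsChainMap dP dQ f) (hg : IsChainMap dQ dP g)
    (hs : IsHomotopyFromId dP (fun i => g i ∘ₗ f i) s)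
    (ht : IsHomotopyFromId dQ (fun i => f i ∘ₗ g i) t)
    {grP : ∀ i, (σ →₀ ℕ) → Submodule k (P i)} {grQ : ∀ i, (σ →₀ ℕ) → Submodule k (Q i)}
    (hfgr : ∀ i α, Set.MapsTo (f i) (grP i α) (grQ i α))
    (hggr : ∀ i α, Set.MapsTo (g i) (grQ i α) (grP i α)) :
    hilbResidue ε dP grP = hilbResidue ε dQ grQ := by
  have hs' := hs.residueMap ε
  have ht' := ht.residueMap ε
  simp only [residueMap_comp] at hs' ht'
  exact hilbHomology_eq_of_homotopyEquiv (hf.residueMap ε) (hg.residueMap ε) hs' ht'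
    (fun i α => residueMap_mapsTo_piece ε (hfgr i α))
    (fun i α => residueMap_mapsTo_piece ε (hggr i α))

end ResidueInvariance

/-! ### Homogeneous bases -/

section HomogeneousBasis

variable {k : Type*} [Field k] {σ : Type*} {V W J : Type*} [AddCommGroup V] [Module k V]
  [AddCommGroup W] [Module k W]

/-- The basis `v` consists of homogeneous vectors: the component of multidegree `α` of the
multigrading `gr` is spanned by the vectors `v j` with `deg j = α`. -/
def IsHomogeneousBasis (gr : (σ →₀ ℕ) → Submodule k V) (v : Module.Basis J k V)
    (deg : J → σ →₀ ℕ) : Prop :=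
  ∀ α, gr α = Submodule.span k (v '' {j | deg j = α})

namespace IsHomogeneousBasis

variable {gr : (σ →₀ ℕ) → Submodule k V} {v : Module.Basis J k V} {deg : J → σ →₀ ℕ}

theorem mem (h : IsHomogeneousBasis gr v deg) (j : J) : v j ∈ gr (deg j) := by
  rw [h]
  exact Submodule.subset_span ⟨j, rfl, rfl⟩

theorem iSup_eq_top (h : IsHomogeneousBasis gr v deg) : ⨆ α, gr α = ⊤ := by
  rw [eq_top_iff, ← v.span_eq, Submodule.span_le]
  rintro _ ⟨j, rfl⟩
  exact Submodule.mem_iSup_of_mem (deg j) (h.mem j)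

theorem iSupIndep (h : IsHomogeneousBasis gr v deg) : iSupIndep gr := by
  intro α
  have hle : ⨆ β, ⨆ (_ : β ≠ α), gr β ≤ Submodule.span k (v '' {j | deg j ≠ α}) := by
    refine iSup₂_le fun β hβ => ?_
    rw [h]
    refine Submodule.span_mono (Set.image_mono ?_)
    rintro j rfl
    exact hβ
  refine Disjoint.mono_right hle ?_
  rw [h]
  exact v.linearIndependent.disjoint_span_image
    (Set.disjoint_left.2 fun _ hj hj' => hj' hj)

theorem dimK_eq (h : IsHomogeneousBasis gr v deg) (α : σ →₀ ℕ) :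
    dimK (k := k) (gr α) = ENat.card {j // deg j = α} := by
  have hli : LinearIndependent k fun j : {j // deg j = α} => v j :=
    v.linearIndependent.comp _ Subtype.val_injective
  have hspan : gr α = Submodule.span k (Set.range fun j : {j // deg j = α} => v j) := by
    rw [h, Set.image_eq_range]
    rfl
  rw [hspan, dimK_congr hli.linearCombinationEquiv.symm, dimK, rank_finsupp_self,
    Cardinal.toENat_lift]
  rfl

end IsHomogeneousBasis

theorem exists_homogeneous_preimage {f : V →ₗ[k] W} {grV : (σ →₀ ℕ) → Submodule k V}
    {grW : (σ →₀ ℕ) → Submodule k W} (hV : ⨆ α, grV α = ⊤) (hW : iSupIndep grW)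
    (hf : ∀ α, Set.MapsTo f (grV α) (grW α)) {α : σ →₀ ℕ} {z : W} (hz : z ∈ grW α)
    (hr : z ∈ LinearMap.range f) : ∃ x ∈ grV α, f x = z := by
  obtain ⟨x, rfl⟩ := hr
  have hx : x ∈ grV α ⊔ ⨆ β, ⨆ (_ : β ≠ α), grV β := by
    rw [← iSup_split_single]
    exact hV ▸ Submodule.mem_top
  obtain ⟨y, hy, y', hy', rfl⟩ := Submodule.mem_sup.1 hx
  refine ⟨y, hy, ?_⟩
  have hother : f y' ∈ ⨆ β, ⨆ (_ : β ≠ α), grW β := by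
    have hle : ⨆ β, ⨆ (_ : β ≠ α), grV β ≤ (⨆ β, ⨆ (_ : β ≠ α), grW β).comap f :=
      iSup₂_le fun β hβ x hx => Submodule.mem_iSup_of_mem β
        (Submodule.mem_iSup_of_mem hβ (hf β hx))
    exact hle hy'
  have hsame : f y' ∈ grW α := by
    simpa using Submodule.sub_mem _ hz (hf α hy)
  have hzero : f y' = 0 := (hW α).le_bot ⟨hsame, hother⟩
  rw [map_add, hzero, add_zero]

end HomogeneousBasis

/-! ### Comparison of multigraded free resolutions -/

section BasisPiece

variable {k : Type*} [Field k] {σ : Type*} {R : Type*} [Ring R] [Algebra k R]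
  (Rgr : (σ →₀ ℕ) → Submodule k R) {M B : Type*} [AddCommGroup M] [Module k M] [Module R M]
  (b : Module.Basis B R M) (deg : B → σ →₀ ℕ)

/-- The component of multidegree `α` of a free module with basis `b`, the basis element `b c` being
homogeneous of multidegree `deg c`. For the standard basis of `B →₀ R` this is `freePiece`. -/
def basisPiece (α : σ →₀ ℕ) : Submodule k M :=
  Submodule.span k {z | ∃ c, ∃ γ, γ + deg c = α ∧ ∃ r ∈ Rgr γ, z = r • b c}

theorem freePiece_eq_basisPiece :
    freePiece Rgr deg = basisPiece Rgr Finsupp.basisSingleOne deg := by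
  funext α
  simp [freePiece, basisPiece]

variable [IsScalarTower k R M]

variable {Rgr} in
theorem IsHomogeneousBasis.smulTower {J : Type*} {v : Module.Basis J k R} {degR : J → σ →₀ ℕ}
    (hv : IsHomogeneousBasis Rgr v degR) :
    IsHomogeneousBasis (basisPiece Rgr b deg) (v.smulTower b) fun j => degR j.1 + deg j.2 := by
  refine fun α => le_antisymm (Submodule.span_le.2 ?_) (Submodule.span_le.2 ?_)
  · rintro _ ⟨c, γ, hγ, r, hr, rfl⟩
    have hle : Rgr γ ≤ (Submodule.span k (v.smulTower b '' {j | degR j.1 + deg j.2 = α})).comap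
        ((LinearMap.toSpanSingleton R M (b c)).restrictScalars k) := by
      rw [hv γ, Submodule.span_le]
      rintro _ ⟨j, rfl, rfl⟩
      exact Submodule.subset_span ⟨(j, c), hγ, Module.Basis.smulTower_apply v b (j, c)⟩
    exact hle hr
  · rintro _ ⟨⟨j, c⟩, hj, rfl⟩
    exact Submodule.subset_span
      ⟨c, degR j, hj, v j, hv.mem j, Module.Basis.smulTower_apply v b (j, c)⟩

instance gradedSMul_basisPiece [SetLike.GradedMonoid Rgr] :
    SetLike.GradedSMul Rgr (basisPiece Rgr b deg) where
  smul_mem α β r x hr hx := by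
    have hle : basisPiece Rgr b deg β ≤
        (basisPiece Rgr b deg (α + β)).comap (Algebra.lsmul k k M r) := by
      refine Submodule.span_le.2 ?_
      rintro _ ⟨c, γ, rfl, s, hs, rfl⟩
      exact Submodule.subset_span ⟨c, α + γ, add_assoc _ _ _, r * s, SetLike.mul_mem_graded hr hs,
        (mul_smul _ _ _).symm⟩
    exact hle hx

variable {b deg} in
theorem mapsTo_basisPiece {N : Type*} [AddCommGroup N] [Module k N] [Module R N]
    [IsScalarTower k R N] {Ngr : (σ →₀ ℕ) → Submodule k N} [SetLike.GradedSMul Rgr Ngr]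
    {f : M →ₗ[R] N} (hf : ∀ c, f (b c) ∈ Ngr (deg c)) (α : σ →₀ ℕ) :
    Set.MapsTo f (basisPiece Rgr b deg α) (Ngr α) := by
  have hle : basisPiece Rgr b deg α ≤ (Ngr α).comap (f.restrictScalars k) := by
    refine Submodule.span_le.2 ?_
    rintro _ ⟨c, γ, rfl, r, hr, rfl⟩
    change f (r • b c) ∈ Ngr _
    rw [map_smul]
    exact SetLike.GradedSMul.smul_mem hr (hf c)
  exact hle

end BasisPiece

section Lift

variable {R : Type*} [Ring R] {M V W : Type*} [AddCommGroup M] [Module R M] [AddCommGroup V]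
  [Module R V] [AddCommGroup W] [Module R W] {f : V →ₗ[R] W} {φ : M →ₗ[R] W}

theorem exists_lift_of_range_le [Module.Projective R M]
    (h : LinearMap.range φ ≤ LinearMap.range f) : ∃ ψ : M →ₗ[R] V, f ∘ₗ ψ = φ := by
  obtain ⟨ψ, hψ⟩ := Module.projective_lifting_property f.rangeRestrict
    (φ.codRestrict _ fun x => h ⟨x, rfl⟩) f.surjective_rangeRestrict
  exact ⟨ψ, LinearMap.ext fun x => congrArg Subtype.val (LinearMap.congr_fun hψ x)⟩

theorem exists_homogeneous_lift_of_range_le {k σ B : Type*} [Field k] [Algebra k R] [Module k V]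
    [IsScalarTower k R V] [Module k W] [IsScalarTower k R W] (b : Module.Basis B R M)
    {deg : B → σ →₀ ℕ} {grV : (σ →₀ ℕ) → Submodule k V} {grW : (σ →₀ ℕ) → Submodule k W}
    (hV : ⨆ α, grV α = ⊤) (hW : iSupIndep grW) (hf : ∀ α, Set.MapsTo f (grV α) (grW α))
    (hφ : ∀ j, φ (b j) ∈ grW (deg j)) (h : LinearMap.range φ ≤ LinearMap.range f) :
    ∃ ψ : M →ₗ[R] V, f ∘ₗ ψ = φ ∧ ∀ j, ψ (b j) ∈ grV (deg j) := by
  choose y hygr hy using fun j =>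
    exists_homogeneous_preimage (f := f.restrictScalars k) hV hW hf (hφ j) (h ⟨b j, rfl⟩)
  refine ⟨b.constr ℕ y, b.ext fun j => ?_, fun j => ?_⟩
  · rw [LinearMap.comp_apply, Module.Basis.constr_basis]
    exact hy j
  · rw [Module.Basis.constr_basis]
    exact hygr j

theorem range_le_range_of_exact {Z : Type*} [AddCommGroup Z] [Module R Z] {g : W →ₗ[R] Z}
    (hfg : Function.Exact f g) (hφ : g ∘ₗ φ = 0) : LinearMap.range φ ≤ LinearMap.range f :=
  (LinearMap.range_le_ker_iff.2 hφ).trans_eq hfg.linearMap_ker_eq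

end Lift

theorem exists_seq_of_step {T : ℕ → Type*} {G : ∀ i, T i → Prop} {r : ∀ i, T i → T (i + 1) → Prop}
    {t₀ : T 0} (h₀ : G 0 t₀) (step : ∀ i t, G i t → ∃ t', G (i + 1) t' ∧ r i t t') :
    ∃ t : ∀ i, T i, t 0 = t₀ ∧ (∀ i, G i (t i)) ∧ ∀ i, r i (t i) (t (i + 1)) := by
  choose f hG hr using step
  let u : ∀ i, {t : T i // G i t} := fun i =>
    Nat.rec ⟨t₀, h₀⟩ (fun i t => ⟨f i t.1 t.2, hG i t.1 t.2⟩) i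
  exact ⟨fun i => (u i).1, rfl, fun i => (u i).2, fun i => hr i (u i).1 (u i).2⟩

section Comparison

universe w w'

variable {k : Type*} [Field k] {σ : Type*} {R : Type*} [Ring R] [Algebra k R]
  {N : Type*} [AddCommGroup N] [Module k N] [Module R N]

/-- `⋯ → P 1 → P 0 → N → 0` is a multigraded resolution of `N` by free modules with homogeneous
bases `b i`. This is the coordinate-free form of `IsMultigradedFreeResolution`, which requires
`P i` to be a module of finitely supported functions. -/
structure IsGradedBasisResolution (Rgr : (σ →₀ ℕ) → Submodule k R)
    (Ngr : (σ →₀ ℕ) → Submodule k N) {P : ℕ → Type*} [∀ i, AddCommGroup (P i)]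
    [∀ i, Module k (P i)] [∀ i, Module R (P i)] {B : ℕ → Type*}
    (b : ∀ i, Module.Basis (B i) R (P i)) (deg : ∀ i, B i → σ →₀ ℕ)
    (d : ∀ i, P (i + 1) →ₗ[R] P i) (aug : P 0 →ₗ[R] N) : Prop where
  aug_surjective : Function.Surjective aug
  exact_zero : Function.Exact (d 0) aug
  exact_succ : ∀ i, Function.Exact (d (i + 1)) (d i)
  aug_homogeneous : ∀ c, aug (b 0 c) ∈ Ngr (deg 0 c)
  d_homogeneous : ∀ i c, d i (b (i + 1) c) ∈ basisPiece Rgr (b i) (deg i) (deg (i + 1) c)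

variable {Rgr : (σ →₀ ℕ) → Submodule k R} {Ngr : (σ →₀ ℕ) → Submodule k N}

theorem IsMultigradedFreeResolution.isGradedBasisResolution
    {B : ℕ → Type*} {deg : ∀ i, B i → σ →₀ ℕ} {d : ∀ i, (B (i + 1) →₀ R) →ₗ[R] (B i →₀ R)}
    {aug : (B 0 →₀ R) →ₗ[R] N} (h : IsMultigradedFreeResolution Rgr Ngr deg d aug) :
    IsGradedBasisResolution Rgr Ngr (fun _ => Finsupp.basisSingleOne) deg d aug where
  aug_surjective := h.aug_surjective
  exact_zero := h.exact_zero
  exact_succ := h.exact_succ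
  aug_homogeneous c := by simpa using h.aug_homogeneous c
  d_homogeneous i c := by simpa [← freePiece_eq_basisPiece] using h.d_homogeneous i c

namespace IsGradedBasisResolution

variable {P : ℕ → Type w} [∀ i, AddCommGroup (P i)] [∀ i, Module k (P i)] [∀ i, Module R (P i)]
  {B : ℕ → Type*} {b : ∀ i, Module.Basis (B i) R (P i)} {degB : ∀ i, B i → σ →₀ ℕ}
  {dP : ∀ i, P (i + 1) →ₗ[R] P i} {augP : P 0 →ₗ[R] N}

theorem exists_homotopy (hP : IsGradedBasisResolution Rgr Ngr b degB dP augP)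
    {g : ∀ i, P i →ₗ[R] P i} (hg : IsChainMap dP dP g) (hg₀ : augP ∘ₗ g 0 = augP) :
    ∃ s, IsHomotopyFromId dP g s := by
  have hproj i : Module.Projective R (P i) := .of_basis (b i)
  obtain ⟨s₀, hs₀⟩ := exists_lift_of_range_le (φ := g 0 - LinearMap.id)
    (range_le_range_of_exact hP.exact_zero (by rw [LinearMap.comp_sub, hg₀, LinearMap.comp_id,
      sub_self]))
  obtain ⟨s, hs, -, hstep⟩ := exists_seq_of_step (T := fun i => P i →ₗ[R] P (i + 1))
    (G := fun i s => dP i ∘ₗ s ∘ₗ dP i = (g i - LinearMap.id) ∘ₗ dP i)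
    (r := fun i s s' => dP (i + 1) ∘ₗ s' = g (i + 1) - LinearMap.id - s ∘ₗ dP i) (t₀ := s₀)
    (by rw [← LinearMap.comp_assoc, hs₀]) fun i s hs => by
      have hdd : dP i ∘ₗ dP (i + 1) = 0 := (hP.exact_succ i).linearMap_comp_eq_zero
      obtain ⟨s', hs'⟩ := exists_lift_of_range_le
        (φ := g (i + 1) - LinearMap.id - s ∘ₗ dP i)
        (range_le_range_of_exact (hP.exact_succ i) (by
          rw [LinearMap.comp_sub, LinearMap.comp_sub, hg, hs, LinearMap.sub_comp,
            LinearMap.comp_id, LinearMap.id_comp, sub_self]))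
      refine ⟨s', ?_, hs'⟩
      rw [← LinearMap.comp_assoc, hs', LinearMap.sub_comp, LinearMap.comp_assoc, hdd,
        LinearMap.comp_zero, sub_zero]
  exact ⟨s, by rw [hs, hs₀], fun i => by rw [hstep, sub_add_cancel]⟩

variable {J : Type*} {v : Module.Basis J k R} {degR : J → σ →₀ ℕ}
  [SetLike.GradedMonoid Rgr] [SetLike.GradedSMul Rgr Ngr] [IsScalarTower k R N]
  [∀ i, IsScalarTower k R (P i)]
  {Q : ℕ → Type w'} [∀ i, AddCommGroup (Q i)] [∀ i, Module k (Q i)] [∀ i, Module R (Q i)]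
  [∀ i, IsScalarTower k R (Q i)] {C : ℕ → Type*} {c : ∀ i, Module.Basis (C i) R (Q i)}
  {degC : ∀ i, C i → σ →₀ ℕ} {dQ : ∀ i, Q (i + 1) →ₗ[R] Q i} {augQ : Q 0 →ₗ[R] N}

theorem exists_chainMap (hv : IsHomogeneousBasis Rgr v degR) (hN : iSupIndep Ngr)
    (hP : IsGradedBasisResolution Rgr Ngr b degB dP augP)
    (hQ : IsGradedBasisResolution Rgr Ngr c degC dQ augQ) :
    ∃ f : ∀ i, P i →ₗ[R] Q i, IsChainMap dP dQ f ∧ augQ ∘ₗ f 0 = augP ∧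
      ∀ i α, Set.MapsTo (f i) (basisPiece Rgr (b i) (degB i) α)
        (basisPiece Rgr (c i) (degC i) α) := by
  have hQv i := hv.smulTower (c i) (degC i)
  obtain ⟨f₀, hf₀, hf₀gr⟩ := exists_homogeneous_lift_of_range_le (b 0) (hQv 0).iSup_eq_top hN
    (mapsTo_basisPiece Rgr hQ.aug_homogeneous) hP.aug_homogeneous
    (by rw [LinearMap.range_eq_top.2 hQ.aug_surjective]; exact le_top)
  obtain ⟨f, hf, hfG, hstep⟩ := exists_seq_of_step (T := fun i => P i →ₗ[R] Q i)
    (G := fun i f => (∀ j, f (b i j) ∈ basisPiece Rgr (c i) (degC i) (degB i j)) ∧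
      LinearMap.range (f ∘ₗ dP i) ≤ LinearMap.range (dQ i))
    (r := fun i f f' => dQ i ∘ₗ f' = f ∘ₗ dP i) (t₀ := f₀)
    ⟨hf₀gr, range_le_range_of_exact hQ.exact_zero (by
      rw [← LinearMap.comp_assoc, hf₀, hP.exact_zero.linearMap_comp_eq_zero])⟩
    fun i f ⟨hfgr, hrange⟩ => by
      obtain ⟨f', hf', hf'gr⟩ := exists_homogeneous_lift_of_range_le (b (i + 1))
        (hQv (i + 1)).iSup_eq_top (hQv i).iSupIndep (mapsTo_basisPiece Rgr (hQ.d_homogeneous i))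
        (fun j => mapsTo_basisPiece Rgr hfgr _ (hP.d_homogeneous i j)) hrange
      refine ⟨f', ⟨hf'gr, range_le_range_of_exact (hQ.exact_succ i) ?_⟩, hf'⟩
      rw [← LinearMap.comp_assoc, hf', LinearMap.comp_assoc,
        (hP.exact_succ i).linearMap_comp_eq_zero, LinearMap.comp_zero]
  exact ⟨f, hstep, by rw [hf, hf₀], fun i => mapsTo_basisPiece Rgr (hfG i).1⟩

theorem hilbResidue_eq (hv : IsHomogeneousBasis Rgr v degR) (hN : iSupIndep Ngr)
    (hP : IsGradedBasisResolution Rgr Ngr b degB dP augP)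
    (hQ : IsGradedBasisResolution Rgr Ngr c degC dQ augQ) (ε : R →ₐ[k] k) :
    hilbResidue ε dP (fun i => basisPiece Rgr (b i) (degB i))
      = hilbResidue ε dQ (fun i => basisPiece Rgr (c i) (degC i)) := by
  obtain ⟨f, hf, hf₀, hfgr⟩ := hP.exists_chainMap hv hN hQ
  obtain ⟨g, hg, hg₀, hggr⟩ := hQ.exists_chainMap hv hN hP
  obtain ⟨s, hs⟩ := hP.exists_homotopy (g := fun i => g i ∘ₗ f i) (hg.comp hf)
    (by rw [← LinearMap.comp_assoc, hg₀, hf₀])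
  obtain ⟨t, ht⟩ := hQ.exists_homotopy (g := fun i => f i ∘ₗ g i) (hf.comp hg)
    (by rw [← LinearMap.comp_assoc, hf₀, hg₀])
  exact hilbResidue_eq_of_homotopyEquiv ε hf hg hs ht hfgr hggr

theorem hilbResidue_eq_hilbTor (hv : IsHomogeneousBasis Rgr v degR) (hN : iSupIndep Ngr)
    (hP : IsGradedBasisResolution Rgr Ngr b degB dP augP) {D : ℕ → Type*}
    {deg : ∀ i, D i → σ →₀ ℕ} {d : ∀ i, (D (i + 1) →₀ R) →ₗ[R] (D i →₀ R)}
    {aug : (D 0 →₀ R) →ₗ[R] N} (hd : IsMultigradedFreeResolution Rgr Ngr deg d aug)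
    (ε : R →ₐ[k] k) :
    hilbResidue ε dP (fun i => basisPiece Rgr (b i) (degB i)) = hilbTor ε Rgr deg d := by
  simp only [hP.hilbResidue_eq hv hN hd.isGradedBasisResolution, hilbTor, freePiece_eq_basisPiece]

end IsGradedBasisResolution

end Comparison

/-! ### Tor from a minimal resolution -/

section Minimal

variable {k : Type*} [Field k] {σ : Type*} {R : Type*} [Ring R] [Algebra k R] (ε : R →ₐ[k] k)

/-- The map `k ⊗_R R^(B) → k^(B)` induced by applying `ε` to all coordinates. -/
def residueCoord (B : Type*) : ResidueTensor ε (B →₀ R) →ₗ[k] (B →₀ k) :=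
  Submodule.liftQ _
    (Finsupp.mapRange.linearMap ε.toLinearMap ∘ₗ (TensorProduct.lid k (B →₀ R)).toLinearMap) (by
      rw [residueRel, Submodule.span_le]
      rintro _ ⟨c, r, m, rfl⟩
      rw [SetLike.mem_coe, LinearMap.mem_ker, map_sub, sub_eq_zero]
      ext b
      simp [mul_assoc])

theorem residueCoord_mk {B : Type*} (f : B →₀ R) :
    residueCoord ε B (residueMk ε f) = f.mapRange ε (map_zero ε) := by
  simp [residueCoord, residueMk]

theorem residueMk_single {B : Type*} (b : B) (r : R) :
    residueMk ε (Finsupp.single b r) = ε r • residueMk ε (Finsupp.single b (1 : R)) := by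
  rw [← residueMk_smul, Finsupp.smul_single, smul_eq_mul, mul_one]

/-- The basis of `k ⊗_R R^(B)` consisting of the classes of the standard basis vectors. -/
def residueBasis (B : Type*) : Module.Basis B k (ResidueTensor ε (B →₀ R)) :=
  .ofRepr (LinearEquiv.ofLinearMap (residueCoord ε B)
    (Finsupp.linearCombination k fun b => residueMk ε (Finsupp.single b 1))
    (by
      ext b : 2
      simp [residueCoord_mk])
    (residueTensor_hom_ext fun f => by
      induction f using Finsupp.induction_linear with
      | zero => simp
      | add f g hf hg => rw [map_add, map_add, map_add, hf, hg]
      | single b r => simp [residueCoord_mk, residueMk_single ε b r]))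

theorem residueBasis_apply {B : Type*} (b : B) :
    residueBasis ε B b = residueMk ε (Finsupp.single b 1) := by
  change Finsupp.linearCombination k _ (Finsupp.single b 1) = _
  rw [Finsupp.linearCombination_single, one_smul]

variable {ε}

theorem isHomogeneousBasis_residueBasis {Rgr : (σ →₀ ℕ) → Submodule k R} [SetLike.GradedOne Rgr]
    (hε : ∀ γ ≠ 0, ∀ r ∈ Rgr γ, ε r = 0) {B : Type*} (deg : B → σ →₀ ℕ) :
    IsHomogeneousBasis (fun α => ResidueTensor.piece ε (freePiece Rgr deg α)) (residueBasis ε B)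
      deg := by
  refine fun α => le_antisymm (Submodule.map_le_iff_le_comap.2 (Submodule.span_le.2 ?_))
    (Submodule.span_le.2 ?_)
  · rintro _ ⟨b, γ, rfl, r, hr, rfl⟩
    change residueMk ε (Finsupp.single b r) ∈ Submodule.span k (residueBasis ε B '' _)
    rw [residueMk_single]
    by_cases hγ : γ = 0
    · refine Submodule.smul_mem _ _ (Submodule.subset_span ⟨b, ?_, residueBasis_apply ε b⟩)
      exact (zero_add _).symm.trans (congrArg (· + deg b) hγ.symm)
    · rw [hε γ hγ r hr, zero_smul]
      exact Submodule.zero_mem _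
  · rintro _ ⟨b, hb, rfl⟩
    rw [residueBasis_apply]
    exact ⟨_, Submodule.subset_span ⟨b, 0, (zero_add _).trans hb, 1, SetLike.one_mem_graded Rgr,
      rfl⟩, rfl⟩

theorem IsMinimal.map_eq_zero {B : ℕ → Type*} {d : ∀ i, (B (i + 1) →₀ R) →ₗ[R] (B i →₀ R)}
    (hd : IsMinimal ε d) (i : ℕ) : ResidueTensor.map ε (d i) = 0 :=
  residueTensor_hom_ext fun f => (residueBasis ε (B i)).repr.injective <| by
    change residueCoord ε (B i) (residueMk ε (d i f)) = residueCoord ε (B i) 0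
    rw [residueCoord_mk, map_zero]
    exact Finsupp.ext (hd i f)

theorem hilbTor_of_isMinimal {Rgr : (σ →₀ ℕ) → Submodule k R} [SetLike.GradedOne Rgr]
    (hε : ∀ γ ≠ 0, ∀ r ∈ Rgr γ, ε r = 0) {B : ℕ → Type*} (deg : ∀ i, B i → σ →₀ ℕ)
    {d : ∀ i, (B (i + 1) →₀ R) →ₗ[R] (B i →₀ R)} (hd : IsMinimal ε d) (m : Option σ →₀ ℕ) :
    hilbTor ε Rgr deg d m = ENat.card {b : B (m none) // deg _ b = m.some} := by
  have h := dimK_homologyPiece_of_eq_zero (X := fun i => ResidueTensor ε (B i →₀ R))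
    (dX := fun i => ResidueTensor.map ε (d i)) hd.map_eq_zero
    (fun i α => ResidueTensor.piece ε (freePiece Rgr (deg i) α)) (m none) m.some
  exact h.trans ((isHomogeneousBasis_residueBasis hε (deg (m none))).dimK_eq m.some)

end Minimal

/-! ### Multigradings of an algebra and its enveloping algebra -/

section AlgebraGrading

universe u v

variable {k : Type u} [Field k] {A : Type v} [Ring A] [Algebra k A] {σ : Type*} {x : σ → A}

instance gradedMonoid_algPiece : SetLike.GradedMonoid (algPiece (k := k) x) where
  one_mem := Submodule.subset_span ⟨[], by simp, by simp⟩
  mul_mem α β a b ha hb := by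
    have h := Submodule.mul_mem_mul ha hb
    rw [algPiece, algPiece, Submodule.span_mul_span] at h
    refine Submodule.span_mono ?_ h
    rintro _ ⟨_, ⟨l, rfl, rfl⟩, _, ⟨l', rfl, rfl⟩, rfl⟩
    exact ⟨l ++ l', by simp, by simp⟩

theorem generator_mem_algPiece (s : σ) : x s ∈ algPiece (k := k) x (Finsupp.single s 1) :=
  Submodule.subset_span ⟨[s], by simp, by simp⟩

theorem tmul_mem_envPiece {α β : σ →₀ ℕ} {a b : A} (ha : a ∈ algPiece (k := k) x α)
    (hb : b ∈ algPiece (k := k) x β) :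
    (a ⊗ₜ[k] MulOpposite.op b : Env k A) ∈ envPiece (k := k) x (α + β) :=
  Submodule.subset_span ⟨α, β, rfl, a, ha, b, hb, rfl⟩

theorem generator_tmul_one_mem_envPiece (s : σ) :
    (x s ⊗ₜ[k] 1 : Env k A) ∈ envPiece (k := k) x (Finsupp.single s 1) := by
  simpa using tmul_mem_envPiece (generator_mem_algPiece (k := k) s) (SetLike.one_mem_graded _)

theorem one_tmul_generator_mem_envPiece (s : σ) :
    (1 ⊗ₜ[k] MulOpposite.op (x s) : Env k A) ∈ envPiece (k := k) x (Finsupp.single s 1) := by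
  simpa using tmul_mem_envPiece (SetLike.one_mem_graded _) (generator_mem_algPiece (k := k) s)

instance gradedMonoid_envPiece : SetLike.GradedMonoid (envPiece (k := k) x) where
  one_mem := by
    have h := tmul_mem_envPiece (SetLike.one_mem_graded (algPiece (k := k) x))
      (SetLike.one_mem_graded (algPiece (k := k) x))
    rwa [add_zero] at h
  mul_mem α β r s hr hs := by
    have h := Submodule.mul_mem_mul hr hs
    rw [envPiece, envPiece, Submodule.span_mul_span] at h
    refine Submodule.span_le.2 ?_ h
    rintro _ ⟨_, ⟨α₁, α₂, rfl, a, ha, b, hb, rfl⟩, _, ⟨β₁, β₂, rfl, c, hc, d, hd, rfl⟩, rfl⟩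
    have := tmul_mem_envPiece (SetLike.mul_mem_graded ha hc) (SetLike.mul_mem_graded hd hb)
    rw [show α₁ + β₁ + (β₂ + α₂) = α₁ + α₂ + (β₁ + β₂) by abel] at this
    simpa using this

instance envScalarTowerSelf : IsScalarTower k (Env k A) A where
  smul_assoc c r m := by
    induction r using TensorProduct.induction_on with
    | zero => rw [smul_zero, zero_smul (Env k A) m, smul_zero]
    | tmul a b =>
      rw [TensorProduct.smul_tmul', env_tmul_smul, env_tmul_smul, smul_mul_assoc, smul_mul_assoc]
    | add r s hr hs =>
      rw [smul_add, add_smul (c • r : Env k A) (c • s) m, hr, hs, add_smul (r : Env k A) s m,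
        smul_add]

instance gradedSMul_algPiece : SetLike.GradedSMul (envPiece (k := k) x) (algPiece (k := k) x) where
  smul_mem α β r m hr hm := by
    have hle : envPiece (k := k) x α ≤ (algPiece (k := k) x (α + β)).comap
        ((LinearMap.toSpanSingleton (Env k A) A m).restrictScalars k) := by
      refine Submodule.span_le.2 ?_
      rintro _ ⟨α₁, α₂, rfl, a, ha, b, hb, rfl⟩
      have := SetLike.mul_mem_graded (SetLike.mul_mem_graded ha hm) hb
      rw [show α₁ + β + α₂ = α₁ + α₂ + β by abel] at this
      simpa [env_tmul_smul] using this
    exact hle hr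

variable {ι : Type*} {v : Module.Basis ι k A} {deg : ι → σ →₀ ℕ}

/-- The basis of the enveloping algebra consisting of the tensors of the elements of a basis of
the algebra. -/
def envBasis (v : Module.Basis ι k A) : Module.Basis (ι × ι) k (Env k A) :=
  v.tensorProduct (v.map (MulOpposite.opLinearEquiv k))

theorem envBasis_apply (j : ι × ι) :
    envBasis v j = v j.1 ⊗ₜ[k] MulOpposite.op (v j.2) := by
  simp [envBasis, Module.Basis.tensorProduct_apply']

theorem IsHomogeneousBasis.envBasis (hv : IsHomogeneousBasis (algPiece (k := k) x) v deg) :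
    IsHomogeneousBasis (envPiece (k := k) x) (envBasis v) fun j => deg j.1 + deg j.2 := by
  refine fun α => le_antisymm (Submodule.span_le.2 ?_) (Submodule.span_le.2 ?_)
  · rintro _ ⟨β, γ, rfl, a, ha, b, hb, rfl⟩
    have h : a ⊗ₜ[k] MulOpposite.op b ∈ Submodule.map₂ (TensorProduct.mk k A Aᵐᵒᵖ)
        (algPiece (k := k) x β)
        ((algPiece (k := k) x γ).map (MulOpposite.opLinearEquiv k).toLinearMap) :=
      Submodule.apply_mem_map₂ _ ha ⟨b, hb, rfl⟩
    rw [hv, hv, Submodule.map_span, Submodule.map₂_span_span] at h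
    refine Submodule.span_mono ?_ h
    rintro _ ⟨_, ⟨j, rfl, rfl⟩, _, ⟨_, ⟨j', rfl, rfl⟩, rfl⟩, rfl⟩
    exact ⟨(j, j'), rfl, envBasis_apply _⟩
  · rintro _ ⟨j, rfl, rfl⟩
    rw [envBasis_apply]
    exact tmul_mem_envPiece (hv.mem _) (hv.mem _)

end AlgebraGrading

/-! ### The Hochschild complex as a multigraded free resolution -/

theorem exists_basis_of_smul {k R M J C L : Type*} [Field k] [Ring R] [Algebra k R] [AddCommGroup M]
    [Module k M] [Module R M] [IsScalarTower k R M] (w : Module.Basis J k R)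
    (u : Module.Basis L k M) (m : C → M) (e : J × C ≃ L) (h : ∀ j c, w j • m c = u (e (j, c))) :
    ∃ b : Module.Basis C R M, ∀ c, b c = m c := by
  let f : (C →₀ R) →ₗ[R] M := Finsupp.linearCombination R m
  let e' : (C →₀ R) ≃ₗ[k] M := (w.smulTower Finsupp.basisSingleOne).equiv u e
  have he : f.restrictScalars k = e'.toLinearMap := by
    refine (w.smulTower Finsupp.basisSingleOne).ext fun j => ?_
    rw [LinearEquiv.coe_coe, Module.Basis.equiv_apply, LinearMap.restrictScalars_apply,
      Module.Basis.smulTower_apply, map_smul, Finsupp.coe_basisSingleOne,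
      Finsupp.linearCombination_single, one_smul, h]
  have hf : (f : _ → _) = e' := funext fun z => LinearMap.congr_fun he z
  have hb : Function.Bijective f := by
    rw [hf]
    exact e'.bijective
  refine ⟨.ofRepr (LinearEquiv.ofBijective f hb).symm, fun c => ?_⟩
  change f (Finsupp.single c 1) = _
  rw [Finsupp.linearCombination_single, one_smul]

section HochschildResolution

variable {k : Type*} [Field k] {A : Type*} [Ring A] [Algebra k A]

/-- The extra degeneracy `a ↦ 1 ⊗ a`, which contracts the augmented Hochschild complex. -/
def HC.extra (i : ℕ) : HC k A i →ₗ[k] HC k A (i + 1) :=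
  PiTensorProduct.lift ((HC.tprod k (i + 1) (A := A)).curryLeft 1)

theorem HC.extra_tprod (i : ℕ) (a : Fin (i + 2) → A) :
    HC.extra i (HC.tprod k i a) = HC.tprod k (i + 1) (Fin.cons 1 a) :=
  PiTensorProduct.lift.tprod a

/-- The multiplication `A ⊗ A → A` as a `k`-linear map. -/
def HC.augLin : HC k A 0 →ₗ[k] A := PiTensorProduct.lift (MultilinearMap.mkPiAlgebraFin k 2 A)

theorem HC.augLin_tprod (a : Fin 2 → A) : HC.augLin (HC.tprod k 0 a) = a 0 * a 1 := by
  have h : HC.augLin (HC.tprod k 0 a) = MultilinearMap.mkPiAlgebraFin k 2 A a :=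
    PiTensorProduct.lift.tprod a
  rw [h, MultilinearMap.mkPiAlgebraFin_apply]
  simp

theorem HC.augLin_smul (r : Env k A) (m : HC k A 0) : HC.augLin (r • m) = r • HC.augLin m := by
  induction r using TensorProduct.induction_on with
  | zero =>
    rw [zero_smul (Env k A) m, zero_smul (Env k A) (HC.augLin m), map_zero]
  | add r s hr hs =>
    rw [add_smul (r : Env k A) s m, add_smul (r : Env k A) s (HC.augLin m), map_add, hr, hs]
  | tmul x y =>
    suffices h : HC.augLin ∘ₗ HC.act k A 0 (x ⊗ₜ[k] y)
        = (Algebra.lsmul k k A (x ⊗ₜ[k] y : Env k A)) ∘ₗ HC.augLin from LinearMap.congr_fun h m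
    refine HC.hom_ext fun a => ?_
    rw [LinearMap.comp_apply, ← HC.smul_def, HC.tmul_smul_tprod, HC.augLin_tprod,
      LinearMap.comp_apply, HC.augLin_tprod, Algebra.lsmul_coe]
    dsimp only
    rw [env_tmul_smul]
    simp [mul_assoc]

variable (k A)

/-- The multiplication `A ⊗ A → A`, the augmentation of the Hochschild complex. -/
def HC.aug : HC k A 0 →ₗ[Env k A] A where
  toFun := HC.augLin
  map_add' := map_add _
  map_smul' := HC.augLin_smul

variable {k A}

/-- The map `a ↦ 1 ⊗ a` from `A` to `A ⊗ A`, a section of the augmentation. -/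
def HC.unitTensor : A →ₗ[k] HC k A 0 where
  toFun a := HC.tprod k 0 ![1, a]
  map_add' a b := by
    have h : ∀ c : A, (![1, c] : Fin 2 → A) = Function.update ![1, 0] 1 c := by
      intro c; funext l; fin_cases l <;> rfl
    rw [h, h a, h b, MultilinearMap.map_update_add]
  map_smul' c a := by
    have h : ∀ c : A, (![1, c] : Fin 2 → A) = Function.update ![1, 0] 1 c := by
      intro c; funext l; fin_cases l <;> rfl
    rw [h, h a, MultilinearMap.map_update_smul]
    rfl

theorem HC.d_extra_zero (m : HC k A 0) :
    HC.d k A 0 (HC.extra 0 m) = m - HC.unitTensor (HC.aug k A m) := by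
  suffices h : HC.dLin 0 ∘ₗ HC.extra 0 = LinearMap.id - HC.unitTensor ∘ₗ HC.augLin (k := k) (A := A)
    from LinearMap.congr_fun h m
  refine HC.hom_ext fun a => ?_
  rw [LinearMap.comp_apply, HC.extra_tprod, HC.dLin_tprod, Fin.sum_univ_two, LinearMap.sub_apply,
    LinearMap.comp_apply, HC.augLin_tprod]
  have h0 : Fin.contractNth (Fin.castSucc (0 : Fin 2)) (· * ·) (Fin.cons 1 a : Fin 3 → A) = a := by
    funext l; fin_cases l <;> (simp [Fin.contractNth]; try rfl)
  have h1 : Fin.contractNth (Fin.castSucc (1 : Fin 2)) (· * ·) (Fin.cons 1 a : Fin 3 → A)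
      = ![1, a 0 * a 1] := by
    funext l; fin_cases l <;> (simp [Fin.contractNth]; try rfl)
  rw [h0, h1]
  simp [HC.unitTensor, sub_eq_add_neg]

theorem HC.d_extra_succ (i : ℕ) (m : HC k A (i + 1)) :
    HC.d k A (i + 1) (HC.extra (i + 1) m) = m - HC.extra i (HC.d k A i m) := by
  suffices h : HC.dLin (i + 1) ∘ₗ HC.extra (i + 1)
      = LinearMap.id - HC.extra i ∘ₗ HC.dLin (k := k) (A := A) i from LinearMap.congr_fun h m
  refine HC.hom_ext fun a => ?_
  rw [LinearMap.comp_apply, HC.extra_tprod, HC.dLin_tprod, Fin.sum_univ_succ, LinearMap.sub_apply,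
    LinearMap.comp_apply, HC.dLin_tprod, map_sum, sub_eq_add_neg, ← Finset.sum_neg_distrib]
  have h0 : Fin.contractNth (Fin.castSucc (0 : Fin (i + 3))) (· * ·)
      (Fin.cons 1 a : Fin (i + 4) → A) = a := by
    funext l
    rcases Fin.eq_zero_or_eq_succ l with rfl | ⟨l, rfl⟩
    · simp [Fin.contractNth]
    · simp [Fin.contractNth]
  have h1 : ∀ j : Fin (i + 2), Fin.contractNth (Fin.castSucc j.succ) (· * ·)
      (Fin.cons 1 a : Fin (i + 4) → A) = Fin.cons 1 (Fin.contractNth j.castSucc (· * ·) a) := by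
    intro j
    funext l
    rcases Fin.eq_zero_or_eq_succ l with rfl | ⟨l, rfl⟩
    · simp [Fin.contractNth]
    · simp [Fin.contractNth]
  congr 1
  · rw [h0]; simp
  · refine Finset.sum_congr rfl fun j _ => ?_
    rw [h1, map_smul, HC.extra_tprod, Fin.val_succ, pow_succ, mul_neg_one, neg_smul]

theorem HC.eq_zero_of_extra_eq_zero {i : ℕ} {M : Type*} [AddCommGroup M] [Module k M]
    [Module (Env k A) M] [IsScalarTower k (Env k A) M]
    {f : HC k A (i + 1) →ₗ[Env k A] M} (hf : ∀ m, f (HC.extra i m) = 0) (m : HC k A (i + 1)) :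
    f m = 0 := by
  suffices h : f.restrictScalars k = 0 from LinearMap.congr_fun h m
  refine HC.hom_ext fun a => ?_
  have h : HC.tprod k (i + 1) a
      = (a 0 ⊗ₜ[k] 1 : Env k A) • HC.extra i (HC.tprod k i (Fin.tail a)) := by
    rw [HC.extra_tprod, HC.tmul_smul_tprod]
    congr 1
    funext l
    rcases Fin.eq_zero_or_eq_succ l with rfl | ⟨l, rfl⟩
    · simp
    · simp [Fin.tail]
  rw [h]
  change f (_ • _) = 0
  rw [map_smul, hf, smul_zero]

theorem HC.aug_d (m : HC k A 1) : HC.aug k A (HC.d k A 0 m) = 0 := by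
  refine HC.eq_zero_of_extra_eq_zero (f := HC.aug k A ∘ₗ HC.d k A 0) (fun m => ?_) m
  rw [LinearMap.comp_apply, HC.d_extra_zero, map_sub, sub_eq_zero]
  change _ = HC.augLin (HC.tprod k 0 ![1, _])
  rw [HC.augLin_tprod]
  simp

theorem HC.d_d (i : ℕ) (m : HC k A (i + 2)) : HC.d k A i (HC.d k A (i + 1) m) = 0 := by
  induction i with
  | zero =>
    refine HC.eq_zero_of_extra_eq_zero (f := HC.d k A 0 ∘ₗ HC.d k A 1) (fun m => ?_) m
    rw [LinearMap.comp_apply, HC.d_extra_succ, map_sub, HC.d_extra_zero, HC.aug_d, map_zero,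
      sub_zero, sub_self]
  | succ i ih =>
    refine HC.eq_zero_of_extra_eq_zero (f := HC.d k A (i + 1) ∘ₗ HC.d k A (i + 2)) (fun m => ?_) m
    rw [LinearMap.comp_apply, HC.d_extra_succ, map_sub, HC.d_extra_succ, ih, map_zero,
      sub_zero, sub_self]

theorem HC.exact_zero : Function.Exact (HC.d k A 0) (HC.aug k A) := by
  refine fun m => ⟨fun hm => ⟨HC.extra 0 m, ?_⟩, ?_⟩
  · rw [HC.d_extra_zero, hm, map_zero, sub_zero]
  · rintro ⟨m, rfl⟩
    exact HC.aug_d m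

theorem HC.exact_succ (i : ℕ) : Function.Exact (HC.d k A (i + 1)) (HC.d k A i) := by
  refine fun m => ⟨fun hm => ⟨HC.extra (i + 1) m, ?_⟩, ?_⟩
  · rw [HC.d_extra_succ, hm, map_zero, sub_zero]
  · rintro ⟨m, rfl⟩
    exact HC.d_d i m

theorem HC.aug_surjective : Function.Surjective (HC.aug k A) := fun a =>
  ⟨HC.unitTensor a, by
    change HC.augLin (HC.tprod k 0 ![1, a]) = a
    rw [HC.augLin_tprod]
    simp⟩

end HochschildResolution

section HochschildBasis

variable {k : Type*} [Field k] {A : Type*} [Ring A] [Algebra k A] {ι : Type*}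
  (v : Module.Basis ι k A)

/-- The basis of `A^{⊗ (i + 2)}` over `k` given by a basis of `A`. -/
def HC.vectorBasis (i : ℕ) : Module.Basis (Fin (i + 2) → ι) k (HC k A i) :=
  Basis.piTensorProduct fun _ : Fin (i + 2) => v

theorem HC.vectorBasis_apply {i : ℕ} (c : Fin (i + 2) → ι) :
    HC.vectorBasis v i c = HC.tprod k i fun l => v (c l) :=
  Basis.piTensorProduct_apply (fun _ : Fin (i + 2) => v) c

theorem HC.vectorBasis_repr_tprod {i : ℕ} (a : Fin (i + 2) → A) (c : Fin (i + 2) → ι) :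
    (HC.vectorBasis v i).repr (HC.tprod k i a) c = ∏ l, v.repr (a l) (c l) :=
  Basis.piTensorProduct_repr_tprod_apply (fun _ : Fin (i + 2) => v) a c

theorem HC.isHomogeneousBasis_vectorBasis {σ : Type*} {x : σ → A} {deg : ι → σ →₀ ℕ}
    (hv : IsHomogeneousBasis (algPiece (k := k) x) v deg) (i : ℕ) :
    IsHomogeneousBasis (HC.piece x i) (HC.vectorBasis v i) fun c => ∑ l, deg (c l) := by
  intro α
  refine le_antisymm (Submodule.span_le.2 ?_) (Submodule.span_le.2 ?_)
  · rintro _ ⟨β, rfl, a, ha, rfl⟩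
    refine (Module.Basis.mem_span_image _).2 fun c hc => ?_
    have hc' : ∏ l, v.repr (a l) (c l) ≠ 0 := by
      rw [← HC.vectorBasis_repr_tprod]
      exact Finsupp.mem_support_iff.1 hc
    rw [Finset.prod_ne_zero_iff] at hc'
    refine Finset.sum_congr rfl fun l _ => ?_
    have h := ha l
    rw [hv, Module.Basis.mem_span_image] at h
    exact h (Finsupp.mem_support_iff.2 (hc' l (Finset.mem_univ l)))
  · rintro _ ⟨c, rfl, rfl⟩
    exact Submodule.subset_span ⟨fun l => deg (c l), rfl, fun l => v (c l), fun l => hv.mem _,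
      HC.vectorBasis_apply v c⟩

/-- Words of length `i + 2` as words of length `i` together with a first and a last letter. -/
def wordEquiv (ι : Type*) (i : ℕ) : (ι × ι) × (Fin i → ι) ≃ (Fin (i + 2) → ι) where
  toFun j := Fin.cons j.1.1 (Fin.snoc j.2 j.1.2 : Fin (i + 1) → ι)
  invFun c := ((c 0, c (Fin.last (i + 1))), fun l => c l.castSucc.succ)
  left_inv j := by
    rcases j with ⟨⟨a, b⟩, c⟩
    simp [← Fin.succ_last]
  right_inv c := by
    funext l
    rcases Fin.eq_zero_or_eq_succ l with rfl | ⟨l, rfl⟩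
    · simp
    · rcases Fin.eq_castSucc_or_eq_last l with ⟨l, rfl⟩ | rfl
      · simp
      · simp

theorem HC.smul_tprod_eq_vectorBasis {i : ℕ} (a b : ι) (c : Fin i → ι) :
    (v a ⊗ₜ[k] MulOpposite.op (v b) : Env k A) •
      HC.tprod k i (Fin.cons 1 (Fin.snoc (fun l => v (c l)) 1 : Fin (i + 1) → A))
      = HC.vectorBasis v i (wordEquiv ι i ((a, b), c)) := by
  rw [HC.tmul_smul_tprod, HC.vectorBasis_apply]
  congr 1
  funext l
  rcases Fin.eq_zero_or_eq_succ l with rfl | ⟨l, rfl⟩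
  · simp [wordEquiv, ← Fin.succ_last, (Fin.succ_ne_zero _).symm]
  · rcases Fin.eq_castSucc_or_eq_last l with ⟨l, rfl⟩ | rfl
    · simp [wordEquiv, ← Fin.succ_last]
    · simp [wordEquiv, ← Fin.succ_last]

theorem HC.exists_basis (i : ℕ) : ∃ b : Module.Basis (Fin i → ι) (Env k A) (HC k A i), ∀ c,
    b c = HC.tprod k i (Fin.cons 1 (Fin.snoc (fun l => v (c l)) 1 : Fin (i + 1) → A)) :=
  exists_basis_of_smul (envBasis v) (HC.vectorBasis v i) _ (wordEquiv ι i) fun j c => by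
    rw [envBasis_apply]
    exact HC.smul_tprod_eq_vectorBasis v _ _ _

/-- The basis of `A^{⊗ (i + 2)}` over `A ⊗ Aᵒᵖ` given by a basis of `A`. -/
def HC.basis (i : ℕ) : Module.Basis (Fin i → ι) (Env k A) (HC k A i) :=
  (HC.exists_basis v i).choose

theorem HC.basis_apply {i : ℕ} (c : Fin i → ι) : HC.basis v i c =
    HC.tprod k i (Fin.cons 1 (Fin.snoc (fun l => v (c l)) 1 : Fin (i + 1) → A)) :=
  (HC.exists_basis v i).choose_spec c

variable {v} {σ : Type*} {x : σ → A} {deg : ι → σ →₀ ℕ}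

theorem HC.basisPiece_eq_piece (hv : IsHomogeneousBasis (algPiece (k := k) x) v deg) (i : ℕ)
    (α : σ →₀ ℕ) :
    basisPiece (envPiece (k := k) x) (HC.basis v i) (fun c => ∑ l, deg (c l)) α
      = HC.piece x i α := by
  rw [hv.envBasis.smulTower (HC.basis v i) _ α,
    HC.isHomogeneousBasis_vectorBasis v hv i α]
  have h1 : ∀ j, ((envBasis v).smulTower (HC.basis v i)) j
      = HC.vectorBasis v i (wordEquiv ι i j) := by
    intro j
    rw [Module.Basis.smulTower_apply, envBasis_apply, HC.basis_apply]
    exact HC.smul_tprod_eq_vectorBasis v _ _ _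
  have h2 : ∀ j : (ι × ι) × (Fin i → ι), deg j.1.1 + deg j.1.2 + ∑ l, deg (j.2 l)
      = ∑ l, deg (wordEquiv ι i j l) := by
    intro j
    rw [Fin.sum_univ_succ, Fin.sum_univ_castSucc]
    simp only [wordEquiv, Equiv.coe_fn_mk, Fin.cons_zero, Fin.cons_succ, Fin.snoc_castSucc,
      Fin.snoc_last]
    abel
  congr 1
  ext z
  constructor
  · rintro ⟨j, hj, rfl⟩
    exact ⟨wordEquiv ι i j, (h2 j).symm.trans hj, (h1 j).symm⟩
  · rintro ⟨c, hc, rfl⟩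
    refine ⟨(wordEquiv ι i).symm c, (h2 _).trans ?_, ?_⟩
    · rw [Equiv.apply_symm_apply]
      exact hc
    · rw [h1, Equiv.apply_symm_apply]

theorem sum_contractNth {M : Type*} [AddCommMonoid M] {n : ℕ} (j : Fin n) (b : Fin (n + 1) → M) :
    ∑ l, Fin.contractNth j.castSucc (· + ·) b l = ∑ l, b l := by
  induction n with
  | zero => exact j.elim0
  | succ n ih =>
    rw [Fin.sum_univ_succ (n := n + 1), Fin.sum_univ_succ (n := n)]
    rcases Fin.eq_zero_or_eq_succ j with rfl | ⟨j, rfl⟩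
    · simp [Fin.contractNth, Fin.sum_univ_succ (n := n), add_assoc]
    · rw [← ih j (fun l => b l.succ)]
      simp [Fin.contractNth]

theorem HC.tprod_mem_piece {i : ℕ} {a : Fin (i + 2) → A} {β : Fin (i + 2) → σ →₀ ℕ}
    (ha : ∀ l, a l ∈ algPiece (k := k) x (β l)) : HC.tprod k i a ∈ HC.piece x i (∑ l, β l) :=
  Submodule.subset_span ⟨β, rfl, a, ha, rfl⟩

theorem HC.d_mapsTo_piece (i : ℕ) (α : σ →₀ ℕ) :
    Set.MapsTo (HC.d k A i) (HC.piece (k := k) x (i + 1) α) (HC.piece (k := k) x i α) := by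
  have h : HC.piece x (i + 1) α ≤ (HC.piece (k := k) x i α).comap (HC.dLin i) := by
    refine Submodule.span_le.2 ?_
    rintro _ ⟨β, rfl, a, ha, rfl⟩
    rw [SetLike.mem_coe, Submodule.mem_comap, HC.dLin_tprod]
    refine Submodule.sum_mem _ fun j _ => Submodule.smul_mem _ _ ?_
    rw [← sum_contractNth j]
    refine HC.tprod_mem_piece fun l => ?_
    simp only [Fin.contractNth]
    split_ifs
    · exact ha _
    · exact SetLike.mul_mem_graded (ha _) (ha _)
    · exact ha _
  exact h

theorem HC.isGradedBasisResolution (hv : IsHomogeneousBasis (algPiece (k := k) x) v deg) :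
    IsGradedBasisResolution (envPiece (k := k) x) (algPiece (k := k) x) (HC.basis v)
      (fun _ c => ∑ l, deg (c l)) (HC.d k A) (HC.aug k A) where
  aug_surjective := HC.aug_surjective
  exact_zero := HC.exact_zero
  exact_succ := HC.exact_succ
  aug_homogeneous c := by
    change HC.augLin _ ∈ _
    have h : (Fin.cons 1 (Fin.snoc (fun l => v (c l)) 1 : Fin 1 → A) : Fin 2 → A) 1 = 1 := rfl
    rw [HC.basis_apply, HC.augLin_tprod, h, mul_one]
    simpa using SetLike.one_mem_graded (algPiece (k := k) x)
  d_homogeneous i c := by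
    rw [HC.basisPiece_eq_piece hv]
    refine HC.d_mapsTo_piece i _ ?_
    rw [← HC.basisPiece_eq_piece hv]
    exact Submodule.subset_span ⟨c, 0, zero_add _, 1,
      SetLike.one_mem_graded _, (one_smul _ _).symm⟩

theorem hilbHH_eq_hilbTor (hv : IsHomogeneousBasis (algPiece (k := k) x) v deg)
    (ε : A →ₐ[k] k) {B : ℕ → Type*} {degB : ∀ i, B i → σ →₀ ℕ}
    {d : ∀ i, (B (i + 1) →₀ Env k A) →ₗ[Env k A] (B i →₀ Env k A)}
    {aug : (B 0 →₀ Env k A) →ₗ[Env k A] A}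
    (hP : IsMultigradedFreeResolution (envPiece (k := k) x) (algPiece (k := k) x) degB d aug) :
    hilbHH ε x = hilbTor (envAug ε) (envPiece (k := k) x) degB d := by
  have h := (HC.isGradedBasisResolution hv).hilbResidue_eq_hilbTor hv.envBasis hv.iSupIndep hP
    (envAug ε)
  rw [← h, hilbHH]
  congr 1
  funext i α
  exact (HC.basisPiece_eq_piece hv i α).symm

end HochschildBasis

/-! ### Augmented graded algebras and minimality -/

section Minimality

variable {k : Type*} [Field k] {σ : Type*}

/-- A resolution whose generators in homological degree `i` have total degree `i` is minimal: the
coefficients of its differential have nonzero multidegree. -/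
theorem IsMultigradedFreeResolution.isMinimal {R : Type*} [Ring R] [Algebra k R] {ε : R →ₐ[k] k}
    {N : Type*} [AddCommGroup N] [Module k N] [Module R N] {Rgr : (σ →₀ ℕ) → Submodule k R}
    {Ngr : (σ →₀ ℕ) → Submodule k N} {B : ℕ → Type*} {deg : ∀ i, B i → σ →₀ ℕ}
    {d : ∀ i, (B (i + 1) →₀ R) →ₗ[R] (B i →₀ R)} {aug : (B 0 →₀ R) →ₗ[R] N}
    (h : IsMultigradedFreeResolution Rgr Ngr deg d aug)
    (hε : ∀ γ ≠ 0, ∀ r ∈ Rgr γ, ε r = 0) (hdeg : ∀ i b, (deg i b).degree = i) :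
    IsMinimal ε d := by
  intro i y b
  have hpiece : ∀ c, freePiece Rgr (deg i) (deg (i + 1) c)
      ≤ LinearMap.ker (ε.toLinearMap ∘ₗ (Finsupp.lapply b : (B i →₀ R) →ₗ[k] R)) := by
    refine fun c => Submodule.span_le.2 ?_
    rintro _ ⟨b', γ, hγ, r, hr, rfl⟩
    have hγ0 : γ ≠ 0 := by
      rintro rfl
      have := congrArg Finsupp.degree hγ
      rw [zero_add, hdeg, hdeg] at this
      omega
    change ε (Finsupp.single b' r b) = 0
    by_cases hb : b = b'
    · rw [hb, Finsupp.single_eq_same, hε γ hγ0 r hr]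
    · rw [Finsupp.single_eq_of_ne hb, map_zero]
  induction y using Finsupp.induction_linear with
  | zero => simp
  | add y z hy hz => rw [map_add, Finsupp.add_apply, map_add, hy, hz, add_zero]
  | single c r =>
    have hc : ε (d i (Finsupp.single c 1) b) = 0 := hpiece c (h.d_homogeneous i c)
    rw [← mul_one r, ← smul_eq_mul, ← Finsupp.smul_single, map_smul, Finsupp.smul_apply,
      smul_eq_mul, map_mul, hc, mul_zero]

variable {A : Type*} [Ring A] [Algebra k A] {x : σ → A} {ε : A →ₐ[k] k}

theorem aug_eq_zero_of_mem_algPiece (hε : ∀ s, ε (x s) = 0) {γ : σ →₀ ℕ} (hγ : γ ≠ 0) {a : A}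
    (ha : a ∈ algPiece (k := k) x γ) : ε a = 0 := by
  have h : algPiece (k := k) x γ ≤ LinearMap.ker ε.toLinearMap := by
    refine Submodule.span_le.2 ?_
    rintro _ ⟨l, hl, rfl⟩
    cases l with
    | nil => exact absurd hl.symm hγ
    | cons s l => simp [hε]
  exact h ha

theorem envAug_tmul (a b : A) : envAug ε (a ⊗ₜ[k] MulOpposite.op b) = ε a * ε b := by
  simp [envAug]

theorem envAug_eq_zero_of_mem_envPiece (hε : ∀ s, ε (x s) = 0) (γ : σ →₀ ℕ) (hγ : γ ≠ 0)
    (r : Env k A) (hr : r ∈ envPiece (k := k) x γ) : envAug ε r = 0 := by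
  have h : envPiece (k := k) x γ ≤ LinearMap.ker (envAug ε).toLinearMap := by
    refine Submodule.span_le.2 ?_
    rintro _ ⟨α, β, rfl, a, ha, b, hb, rfl⟩
    rw [SetLike.mem_coe, LinearMap.mem_ker, AlgHom.toLinearMap_apply, envAug_tmul]
    by_cases h : α = 0
    · have h' : β ≠ 0 := fun h' => hγ (by rw [h, h', add_zero])
      rw [aug_eq_zero_of_mem_algPiece hε h' hb, mul_zero]
    · rw [aug_eq_zero_of_mem_algPiece hε h ha, zero_mul]
  exact h hr

end Minimality

/-! ### Exactness at the augmentation -/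

section Exactness

variable {k : Type*} [Field k] {A : Type*} [Ring A] [Algebra k A] {σ : Type*} {x : σ → A}

variable (k) in
/-- The generator `a ⊗ 1 - 1 ⊗ a` of the kernel of the multiplication `A ⊗ Aᵒᵖ → A`. -/
def envDiff (a : A) : Env k A := a ⊗ₜ[k] 1 - 1 ⊗ₜ[k] MulOpposite.op a

theorem envDiff_smul_one (a : A) : envDiff k a • (1 : A) = 0 := by
  rw [envDiff, sub_smul (a ⊗ₜ[k] 1 : Env k A) (1 ⊗ₜ[k] MulOpposite.op a) (1 : A), env_tmul_smul,
    env_tmul_smul]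
  simp

theorem envDiff_generator_mem_envPiece (s : σ) :
    envDiff k (x s) ∈ envPiece (k := k) x (Finsupp.single s 1) :=
  Submodule.sub_mem _ (generator_tmul_one_mem_envPiece s) (one_tmul_generator_mem_envPiece s)

theorem list_prod_tmul_sub_mem {I : Submodule (Env k A) (Env k A)}
    (hI : ∀ s, envDiff k (x s) ∈ I) (l : List σ) (b : A) :
    (l.map x).prod ⊗ₜ[k] MulOpposite.op b - 1 ⊗ₜ[k] MulOpposite.op ((l.map x).prod * b) ∈ I := by
  induction l using List.reverseRecOn generalizing b with
  | nil => simp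
  | append_singleton l s ih =>
    have h := I.smul_mem ((l.map x).prod ⊗ₜ[k] MulOpposite.op b : Env k A) (hI s)
    convert I.add_mem h (ih (x s * b)) using 1
    simp [envDiff, mul_sub, mul_assoc]

theorem tmul_sub_mem (hA : ⨆ α, algPiece (k := k) x α = ⊤) {I : Submodule (Env k A) (Env k A)}
    (hI : ∀ s, envDiff k (x s) ∈ I) (a b : A) :
    a ⊗ₜ[k] MulOpposite.op b - 1 ⊗ₜ[k] MulOpposite.op (a * b) ∈ I := by
  let f : A →ₗ[k] Env k A :=
    (TensorProduct.mk k A Aᵐᵒᵖ).flip (MulOpposite.op b)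
      - (TensorProduct.mk k A Aᵐᵒᵖ 1) ∘ₗ (MulOpposite.opLinearEquiv k).toLinearMap
        ∘ₗ LinearMap.mulRight k b
  have hf : ⨆ α, algPiece (k := k) x α ≤ (I.restrictScalars k).comap f := by
    refine iSup_le fun α => Submodule.span_le.2 ?_
    rintro _ ⟨l, -, rfl⟩
    exact list_prod_tmul_sub_mem hI l b
  rw [hA] at hf
  exact hf (Submodule.mem_top (x := a))

theorem env_sub_mem (hA : ⨆ α, algPiece (k := k) x α = ⊤) {I : Submodule (Env k A) (Env k A)}
    (hI : ∀ s, envDiff k (x s) ∈ I) (r : Env k A) :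
    r - 1 ⊗ₜ[k] MulOpposite.op (r • (1 : A)) ∈ I := by
  induction r using TensorProduct.induction_on with
  | zero =>
    rw [zero_smul (Env k A) (1 : A)]
    simp
  | tmul a b =>
    rw [env_tmul_smul, mul_one]
    exact tmul_sub_mem hA hI a b.unop
  | add r s hr hs =>
    rw [add_smul (r : Env k A) s (1 : A), MulOpposite.op_add, TensorProduct.tmul_add,
      add_sub_add_comm]
    exact I.add_mem hr hs

theorem exact_augmentation (hA : ⨆ α, algPiece (k := k) x α = ⊤) {B₀ B₁ : Type*} [Unique B₀]
    {d : (B₁ →₀ Env k A) →ₗ[Env k A] (B₀ →₀ Env k A)}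
    (hd : ∀ b, Finsupp.linearCombination (Env k A) (fun _ => (1 : A)) (d (Finsupp.single b 1)) = 0)
    (hx : ∀ s, Finsupp.single default (envDiff k (x s)) ∈ LinearMap.range d) :
    Function.Exact d (Finsupp.linearCombination (Env k A) fun _ => (1 : A)) := by
  refine LinearMap.exact_of_comp_of_mem_range (Finsupp.lhom_ext' fun b => LinearMap.ext_ring (hd b))
    fun z hz => ?_
  rw [Finsupp.unique_single z, Finsupp.linearCombination_single] at hz
  have h := env_sub_mem hA (I := (LinearMap.range d).comap (Finsupp.lsingle default)) hx (z default)
  rw [hz, MulOpposite.op_zero, TensorProduct.tmul_zero, sub_zero] at h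
  rw [Finsupp.unique_single z]
  exact h

end Exactness

/-! ### Lowering complexes -/

/-- A complex of free `R`-modules with basis `J`, in which `b` has multidegree `deg b` and
homological degree `(deg b).degree`. The differential is
`b ↦ ∑_{j ∈ supp (deg b)} coeff i b j • lower b j` from homological degree `i + 1` to `i`. -/
structure LoweringComplex (R ι J : Type*) [Ring R] where
  deg : J → ι →₀ ℕ
  lower : J → ι → J
  coeff : ℕ → J → ι → R
  deg_lower : ∀ {b j}, deg b j ≠ 0 → deg (lower b j) + Finsupp.single j 1 = deg b
  lower_comm : ∀ b i j, lower (lower b i) j = lower (lower b j) i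
  coeff_mul_self : ∀ m {b j}, deg (lower b j) j ≠ 0 →
    coeff (m + 1) b j * coeff m (lower b j) j = 0
  coeff_mul_add : ∀ m {b i j}, i ≠ j → deg b i ≠ 0 → deg b j ≠ 0 →
    coeff (m + 1) b i * coeff m (lower b i) j + coeff (m + 1) b j * coeff m (lower b j) i = 0

namespace LoweringComplex

variable {R ι J : Type*} [Ring R] (C : LoweringComplex R ι J)

/-- The basis in homological degree `i`. -/
abbrev Basis (i : ℕ) : Type _ := {b : J // (C.deg b).degree = i}

/-- The multiples of the basis element `b` in homological degree `i`; this is `0` if `b` lives in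
another degree, which spares carrying the degree of `lower b j` along. -/
def single (i : ℕ) (b : J) : R →ₗ[R] (C.Basis i →₀ R) :=
  if h : (C.deg b).degree = i then Finsupp.lsingle ⟨b, h⟩ else 0

variable {C}

theorem single_of_eq {i : ℕ} {b : J} (h : (C.deg b).degree = i) (r : R) :
    C.single i b r = Finsupp.single ⟨b, h⟩ r := by
  rw [single, dif_pos h]
  rfl

theorem single_of_ne {i : ℕ} {b : J} (h : (C.deg b).degree ≠ i) : C.single i b = 0 :=
  dif_neg h

theorem degree_deg_lower {b : J} {j : ι} (h : C.deg b j ≠ 0) :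
    (C.deg (C.lower b j)).degree + 1 = (C.deg b).degree := by
  rw [← C.deg_lower h, map_add, Finsupp.degree_single]

theorem deg_lower_apply_of_ne {b : J} {i j : ι} (h : C.deg b i ≠ 0) (hij : i ≠ j) :
    C.deg (C.lower b i) j = C.deg b j := by
  rw [← C.deg_lower h, Finsupp.add_apply, Finsupp.single_eq_of_ne hij.symm, add_zero]

variable (C) in
/-- The differential of a lowering complex. -/
def d (i : ℕ) : (C.Basis (i + 1) →₀ R) →ₗ[R] (C.Basis i →₀ R) :=
  Finsupp.linearCombination R fun b =>
    ∑ j ∈ (C.deg b.1).support, C.single i (C.lower b.1 j) (C.coeff i b.1 j)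

theorem d_single (i : ℕ) (b : J) (r : R) :
    C.d i (C.single (i + 1) b r)
      = ∑ j ∈ (C.deg b).support, C.single i (C.lower b j) (r * C.coeff i b j) := by
  by_cases hb : (C.deg b).degree = i + 1
  · rw [single_of_eq hb, d, Finsupp.linearCombination_single, Finset.smul_sum]
    simp only [← map_smul, smul_eq_mul]
  · rw [single_of_ne hb, LinearMap.zero_apply, map_zero, Finset.sum_eq_zero]
    intro j hj
    rw [single_of_ne, LinearMap.zero_apply]
    have := degree_deg_lower (Finsupp.mem_support_iff.1 hj)
    omega

theorem d_d (i : ℕ) (z : C.Basis (i + 2) →₀ R) : C.d i (C.d (i + 1) z) = 0 := by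
  induction z using Finsupp.induction_linear with
  | zero => simp
  | add y z hy hz => rw [map_add, map_add, hy, hz, add_zero]
  | single b r =>
    obtain ⟨b, hb⟩ := b
    rw [← single_of_eq hb, d_single, map_sum]
    simp only [d_single]
    rw [Finset.sum_sigma']
    refine Finset.sum_involution (fun p _ => ⟨p.2, p.1⟩) ?_ ?_ ?_ fun _ _ => rfl
    all_goals
      rintro ⟨j, l⟩ hp
      simp only [Finset.mem_sigma, Finsupp.mem_support_iff] at hp
      obtain ⟨hj, hl⟩ := hp
    · by_cases hjl : j = l
      · subst hjl
        simp only [mul_assoc, C.coeff_mul_self i hl, mul_zero, map_zero, add_zero]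
      · rw [deg_lower_apply_of_ne hj hjl] at hl
        rw [C.lower_comm b l j, ← map_add, mul_assoc, mul_assoc, ← mul_add,
          C.coeff_mul_add i hjl hj hl, mul_zero, map_zero]
    · rintro hne heq
      obtain rfl : l = j := congrArg Sigma.fst heq
      exact hne (by rw [mul_assoc, C.coeff_mul_self i hl, mul_zero, map_zero])
    · by_cases hjl : j = l
      · subst hjl
        simp [hj, hl]
      · rw [deg_lower_apply_of_ne hj hjl] at hl
        simp [hl, deg_lower_apply_of_ne hl (Ne.symm hjl), hj]

variable {k : Type*} [Field k] [Algebra k R]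

variable (C k) in
/-- For each variable `m`, a map `r • b ↦ op b m r • raise b m` whose graded commutator with the
differential is diagonal, and the identity on the basis elements involving `m`. -/
structure PartialHomotopies where
  raise : J → ι → J
  op : J → ι → R →ₗ[k] R
  deg_raise : ∀ {b m}, op b m ≠ 0 → C.deg (raise b m) = C.deg b + Finsupp.single m 1
  lower_raise_self : ∀ {b m}, op b m ≠ 0 → C.lower (raise b m) m = b
  lower_raise_of_ne : ∀ b {m j}, j ≠ m → C.lower (raise b m) j = raise (C.lower b j) m
  raise_lower : ∀ {b m}, C.deg b m ≠ 0 → raise (C.lower b m) m = b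
  op_mul_self : ∀ i {b m} r, C.deg b m ≠ 0 →
    op b m r * C.coeff (i + 1) (raise b m) m + op (C.lower b m) m (r * C.coeff i b m) = r
  op_mul_of_ne : ∀ i {b m j} r, j ≠ m → C.deg b j ≠ 0 →
    op b m r * C.coeff (i + 1) (raise b m) j + op (C.lower b j) m (r * C.coeff i b j) = 0

namespace PartialHomotopies

variable (P : C.PartialHomotopies k)

/-- The partial homotopy belonging to the variable `m`. -/
def homotopy (m : ι) (i : ℕ) : (C.Basis i →₀ R) →ₗ[k] (C.Basis (i + 1) →₀ R) :=
  Finsupp.lsum k fun b => (C.single (i + 1) (P.raise b.1 m)).restrictScalars k ∘ₗ P.op b.1 m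

theorem homotopy_single (m : ι) {i : ℕ} {b : J} (hb : (C.deg b).degree = i) (r : R) :
    P.homotopy m i (C.single i b r) = C.single (i + 1) (P.raise b m) (P.op b m r) := by
  rw [single_of_eq hb, homotopy, Finsupp.lsum_single]
  rfl

theorem d_homotopy_single [DecidableEq ι] (m : ι) {i : ℕ} {b : J} (hb : (C.deg b).degree = i)
    (r : R) :
    C.d i (P.homotopy m i (C.single i b r))
      = C.single i b (P.op b m r * C.coeff i (P.raise b m) m)
        + ∑ j ∈ (C.deg b).support.erase m, C.single i (P.raise (C.lower b j) m)
            (P.op b m r * C.coeff i (P.raise b m) j) := by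
  rw [P.homotopy_single m hb, d_single]
  by_cases h0 : P.op b m = 0
  · simp [h0]
  have hsupp : (C.deg (P.raise b m)).support = insert m ((C.deg b).support.erase m) := by
    ext j
    by_cases hj : j = m <;> simp [P.deg_raise h0, hj]
  rw [hsupp, Finset.sum_insert (Finset.notMem_erase m _), P.lower_raise_self h0]
  congr 1
  refine Finset.sum_congr rfl fun j hj => ?_
  rw [P.lower_raise_of_ne b (Finset.ne_of_mem_erase hj)]

theorem homotopy_d_single [DecidableEq ι] (m : ι) {i : ℕ} {b : J} (hb : (C.deg b).degree = i + 1)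
    (r : R) :
    P.homotopy m i (C.d i (C.single (i + 1) b r))
      = (if C.deg b m ≠ 0 then C.single (i + 1) b (P.op (C.lower b m) m (r * C.coeff i b m)) else 0)
        + ∑ j ∈ (C.deg b).support.erase m, C.single (i + 1) (P.raise (C.lower b j) m)
            (P.op (C.lower b j) m (r * C.coeff i b j)) := by
  have hterm : ∀ j ∈ (C.deg b).support,
      P.homotopy m i (C.single i (C.lower b j) (r * C.coeff i b j))
        = C.single (i + 1) (P.raise (C.lower b j) m)
            (P.op (C.lower b j) m (r * C.coeff i b j)) := by
    intro j hj
    have := degree_deg_lower (Finsupp.mem_support_iff.1 hj)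
    exact P.homotopy_single m (by omega) _
  rw [d_single, map_sum, Finset.sum_congr rfl hterm]
  by_cases hm : C.deg b m ≠ 0
  · rw [if_pos hm, ← Finset.add_sum_erase _ _ (Finsupp.mem_support_iff.2 hm), P.raise_lower hm]
  · rw [if_neg hm, zero_add, Finset.erase_eq_of_notMem (by simpa using hm)]

theorem d_homotopy_add_homotopy_d (m : ι) (i : ℕ) (b : C.Basis (i + 1)) (r : R) :
    ∃ s, C.d (i + 1) (P.homotopy m (i + 1) (Finsupp.single b r))
      + P.homotopy m i (C.d i (Finsupp.single b r)) = Finsupp.single b s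
        ∧ (C.deg b.1 m ≠ 0 → s = r) := by
  classical
  obtain ⟨b, hb⟩ := b
  rw [← single_of_eq hb, P.d_homotopy_single m hb, P.homotopy_d_single m hb,
    add_add_add_comm, ← Finset.sum_add_distrib, Finset.sum_eq_zero, add_zero]
  · by_cases hm : C.deg b m ≠ 0
    · refine ⟨r, ?_, fun _ => rfl⟩
      rw [if_pos hm, ← map_add, P.op_mul_self i r hm, single_of_eq hb]
    · exact ⟨_, by rw [if_neg hm, add_zero, single_of_eq hb], fun h => absurd h hm⟩
  · intro j hj
    obtain ⟨hjm, hj⟩ := Finset.mem_erase.1 hj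
    rw [← map_add, P.op_mul_of_ne i r hjm (Finsupp.mem_support_iff.1 hj), map_zero]

end PartialHomotopies

theorem apply_eq_of_diagonal {B R : Type*} [Ring R] [Algebra k R] {K : (B →₀ R) →ₗ[k] (B →₀ R)}
    (hK : ∀ c r, ∃ s, K (Finsupp.single c r) = Finsupp.single c s) (c : B) (f : B →₀ R) :
    K f c = K (Finsupp.single c (f c)) c := by
  induction f using Finsupp.induction_linear with
  | zero => simp
  | add f g hf hg =>
    rw [map_add, Finsupp.add_apply, hf, hg, Finsupp.add_apply, Finsupp.single_add, map_add,
      Finsupp.add_apply]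
  | single c' r =>
    by_cases h : c' = c
    · rw [h, Finsupp.single_eq_same]
    · obtain ⟨s, hs⟩ := hK c' r
      rw [hs, Finsupp.single_eq_of_ne (Ne.symm h), Finsupp.single_eq_of_ne (Ne.symm h),
        Finsupp.single_zero, map_zero, Finsupp.zero_apply]

/-- As `d z = 0`, the difference is `(1 - (d h + h d)) z`, and `1 - (d h + h d)` is diagonal and
kills the basis elements involving `m`. -/
theorem PartialHomotopies.cycle_sub_apply_ne_zero (P : C.PartialHomotopies k) (m : ι) {i : ℕ}
    {z : C.Basis (i + 1) →₀ R} (hz : C.d i z = 0) {c : C.Basis (i + 1)}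
    (hc : (z - C.d (i + 1) (P.homotopy m (i + 1) z)) c ≠ 0) : z c ≠ 0 ∧ C.deg c.1 m = 0 := by
  let K : (C.Basis (i + 1) →₀ R) →ₗ[k] (C.Basis (i + 1) →₀ R) :=
    (C.d (i + 1)).restrictScalars k ∘ₗ P.homotopy m (i + 1)
      + P.homotopy m i ∘ₗ (C.d i).restrictScalars k
  have hK : ∀ c r, ∃ s, K (Finsupp.single c r) = Finsupp.single c s ∧ (C.deg c.1 m ≠ 0 → s = r) :=
    P.d_homotopy_add_homotopy_d m i
  have hKz : K z = C.d (i + 1) (P.homotopy m (i + 1) z) := by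
    simp [K, hz]
  rw [← hKz, Finsupp.sub_apply,
    apply_eq_of_diagonal (fun c r => (hK c r).imp fun _ h => h.1) c z] at hc
  refine ⟨fun h0 => hc ?_, not_not.1 fun hm => hc ?_⟩
  · rw [h0, Finsupp.single_zero, map_zero, Finsupp.zero_apply, sub_zero]
  · obtain ⟨s, hs, hsr⟩ := hK c (z c)
    rw [hs, Finsupp.single_eq_same, hsr hm, sub_self]

theorem PartialHomotopies.exists_cycle_sub_apply_ne_zero (P : C.PartialHomotopies k) {i : ℕ}
    {z : C.Basis (i + 1) →₀ R} (hz : C.d i z = 0) (T : Finset ι) :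
    ∃ y, ∀ c, (z - C.d (i + 1) y) c ≠ 0 → z c ≠ 0 ∧ ∀ m ∈ T, C.deg c.1 m = 0 := by
  classical
  induction T using Finset.induction_on with
  | empty => exact ⟨0, fun c hc => ⟨by simpa using hc, by simp⟩⟩
  | insert m T _ ih =>
    obtain ⟨y, hy⟩ := ih
    have hz' : C.d i (z - C.d (i + 1) y) = 0 := by rw [map_sub, hz, d_d, sub_zero]
    refine ⟨y + P.homotopy m (i + 1) (z - C.d (i + 1) y), fun c hc => ?_⟩
    rw [map_add, ← sub_sub] at hc
    obtain ⟨hc', hm⟩ := P.cycle_sub_apply_ne_zero m hz' hc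
    exact ⟨(hy c hc').1, Finset.forall_mem_insert _ _ _ |>.2 ⟨hm, (hy c hc').2⟩⟩

theorem exact (P : C.PartialHomotopies k) (i : ℕ) : Function.Exact (C.d (i + 1)) (C.d i) := by
  classical
  refine LinearMap.exact_of_comp_of_mem_range (LinearMap.ext (d_d i)) fun z hz => ?_
  obtain ⟨y, hy⟩ := P.exists_cycle_sub_apply_ne_zero hz
    (z.support.biUnion fun c => (C.deg c.1).support)
  refine ⟨y, (sub_eq_zero.1 (Finsupp.ext fun c => ?_)).symm⟩
  by_contra hc
  obtain ⟨hzc, hdeg⟩ := hy c hc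
  have h0 : C.deg c.1 = 0 := by
    ext m
    by_contra hm
    exact hm (hdeg m (Finset.mem_biUnion.2
      ⟨c, Finsupp.mem_support_iff.2 hzc, Finsupp.mem_support_iff.2 hm⟩))
  have := c.2
  rw [h0, map_zero] at this
  omega

end LoweringComplex

section Resolution

variable {k : Type*} [Field k] {A : Type*} [Ring A] [Algebra k A] {σ J : Type*} {x : σ → A}
  {C : LoweringComplex (Env k A) σ J}

theorem LoweringComplex.deg_eq_single {b : J} (hb : (C.deg b).degree = 1) {j : σ}
    (hj : C.deg b j ≠ 0) : C.deg b = Finsupp.single j 1 := by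
  have h : (C.deg (C.lower b j)).degree = 0 := by
    have := degree_deg_lower hj
    omega
  rw [← C.deg_lower hj, (Finsupp.degree_eq_zero_iff _).1 h, zero_add]

theorem LoweringComplex.exact_augmentation [Unique (C.Basis 0)]
    (hA : ⨆ α, algPiece (k := k) x α = ⊤) (hJ : ∀ j, ∃ b, C.deg b = Finsupp.single j 1)
    (hcoeff : ∀ b j, C.deg b = Finsupp.single j 1 → C.coeff 0 b j = envDiff k (x j)) :
    Function.Exact (C.d 0) (Finsupp.linearCombination (Env k A) fun _ => (1 : A)) := by
  refine HochschildDuality.exact_augmentation (x := x) hA (fun ⟨b, hb⟩ => ?_) fun j => ?_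
  · rw [← single_of_eq hb, d_single, map_sum]
    refine Finset.sum_eq_zero fun j hj => ?_
    have hj := Finsupp.mem_support_iff.1 hj
    have h0 : (C.deg (C.lower b j)).degree = 0 := by
      have := degree_deg_lower hj
      omega
    rw [single_of_eq h0, Finsupp.linearCombination_single, one_mul,
      hcoeff b j (deg_eq_single hb hj), envDiff_smul_one]
  · obtain ⟨b, hb⟩ := hJ j
    have h0 : (C.deg (C.lower b j)).degree = 0 := by
      have := degree_deg_lower (C := C) (b := b) (j := j) (by simp [hb])
      rw [hb, Finsupp.degree_single] at this
      omega
    refine ⟨C.single 1 b 1, ?_⟩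
    rw [d_single, hb, Finsupp.support_single j one_ne_zero, Finset.sum_singleton, one_mul,
      hcoeff b j hb, single_of_eq h0]
    congr 1
    exact Subsingleton.elim _ _

theorem LoweringComplex.isMultigradedFreeResolution [Unique (C.Basis 0)]
    (P : C.PartialHomotopies k) (hA : ⨆ α, algPiece (k := k) x α = ⊤)
    (hJ : ∀ j, ∃ b, C.deg b = Finsupp.single j 1)
    (hcoeff : ∀ b j, C.deg b = Finsupp.single j 1 → C.coeff 0 b j = envDiff k (x j))
    (hmem : ∀ i b j, C.coeff i b j ∈ envPiece (k := k) x (Finsupp.single j 1)) :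
    IsMultigradedFreeResolution (envPiece x) (algPiece x) (fun i (b : C.Basis i) => C.deg b.1) C.d
      (Finsupp.linearCombination (Env k A) fun _ => (1 : A)) where
  aug_surjective a := ⟨Finsupp.single default (a ⊗ₜ[k] 1), by
    rw [Finsupp.linearCombination_single, env_tmul_smul]
    simp⟩
  exact_zero := exact_augmentation hA hJ hcoeff
  exact_succ := exact P
  aug_homogeneous b := by
    rw [Finsupp.linearCombination_single, one_smul, (Finsupp.degree_eq_zero_iff _).1 b.2]
    exact SetLike.one_mem_graded _
  d_homogeneous i b := by
    obtain ⟨b, hb⟩ := b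
    rw [← single_of_eq hb, d_single]
    refine Submodule.sum_mem _ fun j hj => ?_
    have hj := Finsupp.mem_support_iff.1 hj
    have hi : (C.deg (C.lower b j)).degree = i := by
      have := degree_deg_lower hj
      omega
    rw [single_of_eq hi, one_mul]
    exact Submodule.subset_span
      ⟨⟨_, hi⟩, _, (add_comm _ _).trans (C.deg_lower hj), _, hmem i b j, rfl⟩

end Resolution

/-! ### The exterior algebra -/

section Exterior

variable {k : Type*} [Field k] {n : ℕ}

theorem ExtAlg.x_mul_self (j : Fin n) : ExtAlg.x k n j * ExtAlg.x k n j = 0 :=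
  ExteriorAlgebra.ι_sq_zero _

theorem ExtAlg.x_mul_x (i j : Fin n) :
    ExtAlg.x k n i * ExtAlg.x k n j = -(ExtAlg.x k n j * ExtAlg.x k n i) :=
  eq_neg_of_add_eq_zero_left (ExteriorAlgebra.ι_add_mul_swap _ _)

theorem ExtAlg.aug_x (j : Fin n) : ExtAlg.aug k n (ExtAlg.x k n j) = 0 := by
  simp [ExtAlg.aug, ExtAlg.x, ExteriorAlgebra.algebraMapInv]

variable (k n) in
/-- The basis of squarefree monomials of the exterior algebra. -/
def ExtAlg.basis : Module.Basis (Finset (Fin n)) k (ExtAlg k n) :=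
  (Pi.basisFun k (Fin n)).ExteriorAlgebra

theorem ExtAlg.basis_empty : ExtAlg.basis k n ∅ = 1 := by
  rw [ExtAlg.basis, ExteriorAlgebra.basis_apply_ofCard _ (n := 0) Finset.card_empty]
  simp [ExteriorAlgebra.ιMulti_family]

theorem ExtAlg.basis_singleton (j : Fin n) : ExtAlg.basis k n {j} = ExtAlg.x k n j := by
  rw [ExtAlg.basis, ExteriorAlgebra.basis_apply_ofCard _ (n := 1) (Finset.card_singleton j)]
  have h : ∀ l, Set.powersetCard.ofFinEmbEquiv.symm
      (Set.powersetCard.ofCard (Finset.card_singleton j)) l = j := fun l =>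
    Finset.mem_singleton.1 ((Set.powersetCard.mem_range_ofFinEmbEquiv_symm_iff_mem
      (Set.powersetCard.ofCard (Finset.card_singleton j)) _).1 ⟨l, rfl⟩)
  rw [ExteriorAlgebra.ιMulti_family, ExteriorAlgebra.ιMulti_apply]
  simp [h, ExtAlg.x]

theorem ExtAlg.x_mul_basis_of_mem {j : Fin n} {s : Finset (Fin n)} (h : j ∈ s) :
    ExtAlg.x k n j * ExtAlg.basis k n s = 0 := by
  rw [← ExtAlg.basis_singleton]
  exact ExteriorAlgebra.basis_mul_of_not_disjoint _ ⟨{j}, Finset.card_singleton j⟩ ⟨s, rfl⟩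
    (by simpa using h)

theorem ExtAlg.x_mul_basis_of_notMem {j : Fin n} {s : Finset (Fin n)} (h : j ∉ s) :
    ∃ u : ℤˣ, ExtAlg.x k n j * ExtAlg.basis k n s = u • ExtAlg.basis k n (insert j s) := by
  have hd : Disjoint ({j} : Finset (Fin n)) s := by simpa using h
  have h := ExteriorAlgebra.basis_mul_of_disjoint (Pi.basisFun k (Fin n))
    ⟨{j}, Finset.card_singleton j⟩ ⟨s, rfl⟩ hd
  have hi : insert j s = (Set.powersetCard.disjUnion (s := ⟨{j}, Finset.card_singleton j⟩)
      (t := ⟨s, rfl⟩) hd).val := by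
    ext
    simp
  rw [← ExtAlg.basis_singleton, hi]
  exact ⟨_, h⟩

theorem units_smul_mem_iff {V : Type*} [AddCommGroup V] [Module k V] (W : Submodule k V) (u : ℤˣ)
    {v : V} : u • v ∈ W ↔ v ∈ W := by
  rcases Int.units_eq_one_or u with rfl | rfl <;> simp

/-- The multidegree of the squarefree monomial with support `s`. -/
def finsetDeg (s : Finset (Fin n)) : Fin n →₀ ℕ := ∑ j ∈ s, Finsupp.single j 1

theorem finsetDeg_apply (s : Finset (Fin n)) (j : Fin n) :
    finsetDeg s j = if j ∈ s then 1 else 0 := by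
  simp [finsetDeg, Finsupp.single_apply]

theorem finsetDeg_ne_zero_iff {s : Finset (Fin n)} {j : Fin n} : finsetDeg s j ≠ 0 ↔ j ∈ s := by
  simp [finsetDeg_apply]

theorem finsetDeg_injective : Function.Injective (finsetDeg (n := n)) := by
  intro s t h
  ext j
  rw [← finsetDeg_ne_zero_iff, h, finsetDeg_ne_zero_iff]

theorem finsetDeg_singleton (j : Fin n) : finsetDeg {j} = Finsupp.single j 1 :=
  Finset.sum_singleton _ _

theorem finsetDeg_insert {j : Fin n} {s : Finset (Fin n)} (h : j ∉ s) :
    finsetDeg (insert j s) = Finsupp.single j 1 + finsetDeg s :=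
  Finset.sum_insert h

theorem finsetDeg_erase {j : Fin n} {s : Finset (Fin n)} (h : j ∈ s) :
    finsetDeg (s.erase j) + Finsupp.single j 1 = finsetDeg s :=
  Finset.sum_erase_add _ _ h

theorem ExtAlg.basis_mem_algPiece (s : Finset (Fin n)) :
    ExtAlg.basis k n s ∈ algPiece (k := k) (ExtAlg.x k n) (finsetDeg s) := by
  induction s using Finset.induction_on with
  | empty =>
    rw [ExtAlg.basis_empty]
    exact SetLike.one_mem_graded _
  | insert j s hj ih =>
    obtain ⟨u, hu⟩ := ExtAlg.x_mul_basis_of_notMem (k := k) hj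
    have h := SetLike.mul_mem_graded (generator_mem_algPiece (k := k) (x := ExtAlg.x k n) j) ih
    rwa [hu, ← finsetDeg_insert hj, units_smul_mem_iff] at h

theorem ExtAlg.x_mul_mem_span_basis (j : Fin n) {β : Fin n →₀ ℕ} {a : ExtAlg k n}
    (ha : a ∈ Submodule.span k (ExtAlg.basis k n '' {s | finsetDeg s = β})) :
    ExtAlg.x k n j * a
      ∈ Submodule.span k (ExtAlg.basis k n '' {s | finsetDeg s = Finsupp.single j 1 + β}) := by
  induction ha using Submodule.span_induction with
  | zero => simp
  | add a b _ _ ha hb => simpa only [mul_add] using Submodule.add_mem _ ha hb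
  | smul c a _ ha => simpa only [mul_smul_comm] using Submodule.smul_mem _ c ha
  | mem a ha =>
    obtain ⟨s, rfl, rfl⟩ := ha
    by_cases hj : j ∈ s
    · rw [ExtAlg.x_mul_basis_of_mem hj]
      exact Submodule.zero_mem _
    · obtain ⟨u, hu⟩ := ExtAlg.x_mul_basis_of_notMem (k := k) hj
      rw [hu, units_smul_mem_iff]
      exact Submodule.subset_span ⟨_, finsetDeg_insert hj, rfl⟩

theorem ExtAlg.isHomogeneousBasis_basis :
    IsHomogeneousBasis (algPiece (k := k) (ExtAlg.x k n)) (ExtAlg.basis k n) finsetDeg := by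
  intro α
  refine le_antisymm (Submodule.span_le.2 ?_) (Submodule.span_le.2 ?_)
  · rintro _ ⟨l, rfl, rfl⟩
    induction l with
    | nil => exact Submodule.subset_span ⟨∅, rfl, by simp [ExtAlg.basis_empty]⟩
    | cons j l ih =>
      rw [List.map_cons (f := ExtAlg.x k n), List.prod_cons, List.map_cons, List.sum_cons]
      exact ExtAlg.x_mul_mem_span_basis j ih
  · rintro _ ⟨s, rfl, rfl⟩
    exact ExtAlg.basis_mem_algPiece s

/-- Contraction on the right with the `m`-th coordinate. -/
def ExtAlg.contract (m : Fin n) : ExtAlg k n →ₗ[k] ExtAlg k n :=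
  (CliffordAlgebra.contractRight (R := k) (M := Fin n → k) (Q := 0)).flip (LinearMap.proj m)

theorem ExtAlg.contract_mul_x (m j : Fin n) (a : ExtAlg k n) :
    ExtAlg.contract m (a * ExtAlg.x k n j)
      = (if j = m then a else 0) - ExtAlg.contract m a * ExtAlg.x k n j := by
  have h := CliffordAlgebra.contractRight_mul_ι (Q := (0 : QuadraticForm k (Fin n → k)))
    (LinearMap.proj m) (Pi.single j (1 : k)) a
  rw [LinearMap.proj_apply, Pi.single_apply, ite_smul, one_smul, zero_smul] at h
  simp only [eq_comm (a := m)] at h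
  exact h

theorem ExtAlg.rTensor_contract_mul_x_tmul (m j : Fin n) (r : Env k (ExtAlg k n)) :
    (ExtAlg.contract m).rTensor _ (r * ExtAlg.x k n j ⊗ₜ[k] 1)
      = (if j = m then r else 0)
        - (ExtAlg.contract m).rTensor _ r * ExtAlg.x k n j ⊗ₜ[k] 1 := by
  induction r using TensorProduct.induction_on with
  | zero => simp
  | add r r' hr hr' =>
    rw [add_mul, map_add, map_add, hr, hr', add_mul]
    split_ifs <;> abel
  | tmul a b =>
    rw [Algebra.TensorProduct.tmul_mul_tmul, LinearMap.rTensor_tmul, LinearMap.rTensor_tmul,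
      Algebra.TensorProduct.tmul_mul_tmul, mul_one, ExtAlg.contract_mul_x, TensorProduct.sub_tmul]
    split_ifs
    · rfl
    · rw [TensorProduct.zero_tmul]

theorem ExtAlg.rTensor_contract_mul_one_tmul (m : Fin n) (r : Env k (ExtAlg k n))
    (b : (ExtAlg k n)ᵐᵒᵖ) :
    (ExtAlg.contract m).rTensor _ (r * 1 ⊗ₜ[k] b)
      = (ExtAlg.contract m).rTensor _ r * 1 ⊗ₜ[k] b := by
  induction r using TensorProduct.induction_on with
  | zero => simp
  | add r r' hr hr' => rw [add_mul, map_add, map_add, hr, hr', add_mul]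
  | tmul a c => simp

end Exterior

/-! ### The divided power complex -/

section CartanResolution

variable {k : Type*} [Field k] {n : ℕ}

variable (k) in
/-- The coefficient `x_j ⊗ 1 + s (1 ⊗ x_j)` of the divided power complex. -/
def cartanCoeff (s : k) (j : Fin n) : Env k (ExtAlg k n) :=
  ExtAlg.x k n j ⊗ₜ[k] 1 + s • 1 ⊗ₜ[k] MulOpposite.op (ExtAlg.x k n j)

theorem cartanCoeff_neg (s : k) (j : Fin n) :
    cartanCoeff k (-s) j
      = ExtAlg.x k n j ⊗ₜ[k] 1 - s • 1 ⊗ₜ[k] MulOpposite.op (ExtAlg.x k n j) := by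
  rw [cartanCoeff, TensorProduct.smul_tmul', neg_smul, TensorProduct.neg_tmul, ← sub_eq_add_neg,
    ← TensorProduct.smul_tmul']

theorem cartanCoeff_mem_envPiece (s : k) (j : Fin n) :
    cartanCoeff k s j ∈ envPiece (k := k) (ExtAlg.x k n) (Finsupp.single j 1) :=
  Submodule.add_mem _ (generator_tmul_one_mem_envPiece j)
    (Submodule.smul_mem _ s (one_tmul_generator_mem_envPiece j))

theorem cartanCoeff_mul_add (s : k) (i j : Fin n) :
    cartanCoeff k s i * cartanCoeff k (-s) j + cartanCoeff k s j * cartanCoeff k (-s) i = 0 := by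
  simp only [cartanCoeff, mul_add, add_mul, Algebra.TensorProduct.tmul_mul_tmul, one_mul, mul_one,
    TensorProduct.smul_tmul', neg_smul, mul_neg,
    smul_mul_assoc, mul_smul_comm, ← MulOpposite.op_mul]
  rw [ExtAlg.x_mul_x i j, MulOpposite.op_neg]
  simp only [TensorProduct.tmul_neg, TensorProduct.neg_tmul]
  abel

theorem cartanCoeff_mul_self (s : k) (j : Fin n) :
    cartanCoeff k s j * cartanCoeff k (-s) j = 0 := by
  simp only [cartanCoeff, mul_add, add_mul, Algebra.TensorProduct.tmul_mul_tmul, one_mul, mul_one,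
    TensorProduct.smul_tmul', neg_smul, mul_neg,
    ExtAlg.x_mul_self, smul_mul_assoc, mul_smul_comm, ← MulOpposite.op_mul, MulOpposite.op_zero,
    TensorProduct.tmul_zero, TensorProduct.zero_tmul]
  rw [TensorProduct.neg_tmul]
  abel

theorem rTensor_contract_mul_cartanCoeff (s : k) (m j : Fin n) (r : Env k (ExtAlg k n)) :
    (ExtAlg.contract m).rTensor _ r * cartanCoeff k (-s) j
        + (ExtAlg.contract m).rTensor _ (r * cartanCoeff k s j)
      = if j = m then r else 0 := by
  rw [cartanCoeff_neg]
  simp only [cartanCoeff, mul_add, mul_sub, mul_smul_comm, map_add, map_smul,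
    ExtAlg.rTensor_contract_mul_x_tmul, ExtAlg.rTensor_contract_mul_one_tmul]
  abel

variable (k n) in
/-- The divided power complex: `l` stands for `e_1^{(l_1)} ⋯ e_n^{(l_n)}`. -/
def cartanComplex : LoweringComplex (Env k (ExtAlg k n)) (Fin n) (Fin n →₀ ℕ) where
  deg l := l
  lower l j := l - Finsupp.single j 1
  coeff i _ j := cartanCoeff k ((-1) ^ (i + 1)) j
  deg_lower h := tsub_add_cancel_of_le (Finsupp.single_le_iff.2 (Nat.one_le_iff_ne_zero.2 h))
  lower_comm _ _ _ := tsub_right_comm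
  coeff_mul_self i _ j _ := by
    have h := cartanCoeff_mul_self (-(-1 : k) ^ (i + 1)) j
    rwa [neg_neg, ← mul_neg_one ((-1) ^ (i + 1)), ← pow_succ] at h
  coeff_mul_add i _ j l _ _ _ := by
    have h := cartanCoeff_mul_add (-(-1 : k) ^ (i + 1)) j l
    rwa [neg_neg, ← mul_neg_one ((-1) ^ (i + 1)), ← pow_succ] at h

theorem cartanD_eq : cartanD k n = (cartanComplex k n).d := by
  funext i
  refine congrArg (Finsupp.linearCombination _) (funext fun l => ?_)
  refine (Finset.sum_subset_zero_on_sdiff (Finset.subset_univ l.1.support) (fun j hj => ?_)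
    fun j hj => ?_).symm
  · exact dif_neg (by simpa using hj)
  · have hj : l.1 j ≠ 0 := Finsupp.mem_support_iff.1 hj
    rw [dif_pos hj]
    exact LoweringComplex.single_of_eq (C := cartanComplex k n) (l.lower j hj).2 _

variable (k n) in
/-- The partial homotopies `r e^{(l)} ↦ (r ⌊ m) e_m e^{(l)}`. -/
def cartanHomotopies : (cartanComplex k n).PartialHomotopies k where
  raise l m := l + Finsupp.single m 1
  op _ m := (ExtAlg.contract m).rTensor _
  deg_raise _ := rfl
  lower_raise_self _ := add_tsub_cancel_right _ _
  lower_raise_of_ne l m j hj := by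
    ext p
    change l p + Finsupp.single m 1 p - Finsupp.single j 1 p
      = l p - Finsupp.single j 1 p + Finsupp.single m 1 p
    by_cases hp : p = j
    · simp [hp, hj]
    · simp [Finsupp.single_eq_of_ne hp]
  raise_lower h := (cartanComplex k n).deg_lower h
  op_mul_self i b m r _ := by
    have h := rTensor_contract_mul_cartanCoeff ((-1) ^ (i + 1)) m m r
    rwa [if_pos rfl, ← mul_neg_one, ← pow_succ] at h
  op_mul_of_ne i b m j r hj _ := by
    have h := rTensor_contract_mul_cartanCoeff ((-1) ^ (i + 1)) m j r
    rwa [if_neg hj, ← mul_neg_one, ← pow_succ] at h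

instance : Unique ((cartanComplex k n).Basis 0) where
  default := ⟨0, map_zero _⟩
  uniq l := Subtype.ext ((Finsupp.degree_eq_zero_iff _).1 l.2)

theorem cartanComplex_coeff_zero (l : Fin n →₀ ℕ) (j : Fin n) :
    (cartanComplex k n).coeff 0 l j = envDiff k (ExtAlg.x k n j) := by
  change cartanCoeff k ((-1) ^ (0 + 1)) j = _
  rw [zero_add, pow_one, cartanCoeff_neg, one_smul, envDiff]

theorem cartan_isMultigradedFreeResolution :
    IsMultigradedFreeResolution (N := ExtAlg k n) (envPiece (ExtAlg.x k n))
      (algPiece (ExtAlg.x k n)) (B := CartanBasis n) (fun _ l => l.1) (cartanD k n)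
      (cartanAug k n) := by
  rw [cartanD_eq]
  exact LoweringComplex.isMultigradedFreeResolution (cartanHomotopies k n)
    ExtAlg.isHomogeneousBasis_basis.iSup_eq_top (fun j => ⟨_, rfl⟩)
    (fun l j _ => cartanComplex_coeff_zero l j)
    fun _ _ _ => cartanCoeff_mem_envPiece _ _

theorem cartan_isMinimal : IsMinimal (envAug (ExtAlg.aug k n)) (cartanD k n) :=
  cartan_isMultigradedFreeResolution.isMinimal (envAug_eq_zero_of_mem_envPiece ExtAlg.aug_x)
    fun _ l => l.2

end CartanResolution

/-! ### The Koszul complex -/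

section Koszul

open MvPolynomial

variable {k : Type*} [Field k] {n : ℕ}

theorem list_prod_map_X {σ : Type*} (l : List σ) :
    (l.map (X : σ → MvPolynomial σ k)).prod
      = monomial (l.map fun s => Finsupp.single s 1).sum 1 := by
  induction l with
  | nil => simp
  | cons j l ih =>
    rw [List.map_cons, List.prod_cons, List.map_cons, List.sum_cons, ih, X, monomial_mul, one_mul]

theorem exists_list_sum_map_single {σ : Type*} (α : σ →₀ ℕ) :
    ∃ l : List σ, (l.map fun s => Finsupp.single s 1).sum = α := by
  induction α using Finsupp.induction_linear with
  | zero => exact ⟨[], rfl⟩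
  | add a b ha hb =>
    obtain ⟨l, rfl⟩ := ha
    obtain ⟨l', rfl⟩ := hb
    exact ⟨l ++ l', by rw [List.map_append, List.sum_append]⟩
  | single j m => exact ⟨List.replicate m j, by simp⟩

theorem isHomogeneousBasis_basisMonomials {σ : Type*} :
    IsHomogeneousBasis (algPiece (k := k) (X : σ → MvPolynomial σ k)) (basisMonomials σ k) id := by
  intro α
  rw [coe_basisMonomials]
  refine le_antisymm (Submodule.span_le.2 ?_) (Submodule.span_le.2 ?_)
  · rintro _ ⟨l, rfl, rfl⟩
    exact Submodule.subset_span ⟨_, rfl, (list_prod_map_X l).symm⟩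
  · rintro _ ⟨β, rfl, rfl⟩
    obtain ⟨l, rfl⟩ := exists_list_sum_map_single β
    exact Submodule.subset_span ⟨l, rfl, (list_prod_map_X l).symm⟩

theorem polyAug_X (j : Fin n) : polyAug k n (X j) = 0 := by
  simp [polyAug]

theorem envDiff_mul_comm {A : Type*} [CommRing A] [Algebra k A] (a b : A) :
    envDiff k a * envDiff k b = envDiff k b * envDiff k a := by
  simp only [envDiff, mul_sub, sub_mul, Algebra.TensorProduct.tmul_mul_tmul, one_mul, mul_one,
    ← MulOpposite.op_mul]
  rw [mul_comm a b]
  abel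

section DividedDifference

variable {σ : Type*}

variable (k) in
/-- The divided difference `(p - p|_{x_m = y_m}) / (x_m - y_m)` on `S ⊗ Sᵒᵖ = k[x, y]`. -/
def dividedDifference (m : σ) : Env k (MvPolynomial σ k) →ₗ[k] Env k (MvPolynomial σ k) :=
  TensorProduct.lift ((basisMonomials σ k).constr k fun a => ∑ t ∈ Finset.range (a m),
    TensorProduct.mk k (MvPolynomial σ k) (MvPolynomial σ k)ᵐᵒᵖ
        (monomial (a - Finsupp.single m (t + 1)) 1)
      ∘ₗ LinearMap.mulRight k (MulOpposite.op (X m) ^ t))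

theorem dividedDifference_monomial (m : σ) (a : σ →₀ ℕ) (q : (MvPolynomial σ k)ᵐᵒᵖ) :
    dividedDifference k m (monomial a 1 ⊗ₜ[k] q) = ∑ t ∈ Finset.range (a m),
      monomial (a - Finsupp.single m (t + 1)) 1 ⊗ₜ[k] (q * MulOpposite.op (X m) ^ t) := by
  have h : monomial a (1 : k) = basisMonomials σ k a := by
    rw [coe_basisMonomials]
  rw [h, dividedDifference, TensorProduct.lift.tmul, Module.Basis.constr_basis, LinearMap.sum_apply]
  rfl

theorem monomial_tmul_mul_envDiff_X (j : σ) (a : σ →₀ ℕ) (q : (MvPolynomial σ k)ᵐᵒᵖ) :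
    (monomial a 1 ⊗ₜ[k] q) * envDiff k (X j)
      = monomial (a + Finsupp.single j 1) 1 ⊗ₜ[k] q
        - monomial a 1 ⊗ₜ[k] (q * MulOpposite.op (X j)) := by
  rw [envDiff, mul_sub, Algebra.TensorProduct.tmul_mul_tmul, Algebra.TensorProduct.tmul_mul_tmul,
    mul_one, mul_one, X, monomial_mul, one_mul]

theorem env_mvPolynomial_hom_ext {V : Type*} [AddCommGroup V] [Module k V]
    {f g : Env k (MvPolynomial σ k) →ₗ[k] V}
    (h : ∀ a q, f (monomial a 1 ⊗ₜ[k] q) = g (monomial a 1 ⊗ₜ[k] q)) : f = g := by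
  refine TensorProduct.ext ((basisMonomials σ k).ext fun a => ?_)
  ext q
  rw [coe_basisMonomials]
  exact h a _

theorem dividedDifference_mul_of_ne {m j : σ} (hj : j ≠ m) (r : Env k (MvPolynomial σ k)) :
    dividedDifference k m (r * envDiff k (X j)) = dividedDifference k m r * envDiff k (X j) := by
  suffices h : dividedDifference k m ∘ₗ LinearMap.mulRight k (envDiff k (X j))
      = LinearMap.mulRight k (envDiff k (X j)) ∘ₗ dividedDifference k m from LinearMap.congr_fun h r
  refine env_mvPolynomial_hom_ext fun a q => ?_
  have ham : (a + Finsupp.single j 1 : σ →₀ ℕ) m = a m := by simp [hj]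
  simp only [LinearMap.comp_apply, LinearMap.mulRight_apply, monomial_tmul_mul_envDiff_X, map_sub,
    dividedDifference_monomial, Finset.sum_mul, ham]
  rw [← Finset.sum_sub_distrib]
  refine Finset.sum_congr rfl fun t ht => ?_
  have hle : Finsupp.single m (t + 1) ≤ a := Finsupp.single_le_iff.2 (Finset.mem_range.1 ht)
  rw [tsub_add_eq_add_tsub hle, mul_assoc, mul_assoc,
    mul_comm (MulOpposite.op (X j : MvPolynomial σ k))]

theorem dividedDifference_mul_self (m : σ) (r : Env k (MvPolynomial σ k)) :
    dividedDifference k m (r * envDiff k (X m)) = r := by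
  suffices h : dividedDifference k m ∘ₗ LinearMap.mulRight k (envDiff k (X m))
      = LinearMap.id from LinearMap.congr_fun h r
  refine env_mvPolynomial_hom_ext fun a q => ?_
  have ham : (a + Finsupp.single m 1 : σ →₀ ℕ) m = a m + 1 := by simp
  rw [LinearMap.comp_apply, LinearMap.mulRight_apply, monomial_tmul_mul_envDiff_X, map_sub,
    dividedDifference_monomial, dividedDifference_monomial, ham, Finset.sum_range_succ', zero_add,
    pow_zero, mul_one, add_tsub_cancel_right, LinearMap.id_apply, add_sub_right_comm,
    ← Finset.sum_sub_distrib, Finset.sum_eq_zero, zero_add]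
  intro t _
  rw [Finsupp.single_add m (t + 1) 1, add_tsub_add_eq_tsub_right, mul_assoc, ← pow_succ', sub_self]

end DividedDifference

variable (k) in
/-- The sign of moving `e_j` to the front of `e_I`. -/
def koszulSign (j : Fin n) (I : Finset (Fin n)) : k := (-1) ^ (I.filter (· < j)).card

theorem koszulSign_mul_self (j : Fin n) (I : Finset (Fin n)) :
    koszulSign k j I * koszulSign k j I = 1 := by
  rw [koszulSign, ← mul_pow, neg_mul_neg, one_mul, one_pow]

theorem koszulSign_singleton (j : Fin n) : koszulSign k j {j} = 1 := by
  simp [koszulSign, Finset.filter_singleton]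

theorem koszulSign_erase_of_lt {i j : Fin n} {I : Finset (Fin n)} (hi : i ∈ I) (hij : i < j) :
    koszulSign k j (I.erase i) = -koszulSign k j I := by
  have hmem : i ∈ I.filter (· < j) := Finset.mem_filter.2 ⟨hi, hij⟩
  rw [koszulSign, koszulSign, Finset.filter_erase, ← Finset.card_erase_add_one hmem, pow_succ,
    mul_neg_one, neg_neg]

theorem koszulSign_erase_of_le {i j : Fin n} {I : Finset (Fin n)} (hji : j ≤ i) :
    koszulSign k j (I.erase i) = koszulSign k j I := by
  rw [koszulSign, koszulSign, Finset.filter_erase, Finset.erase_eq_of_notMem]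
  simp [hji]

theorem koszulSign_mul_erase_add {i j : Fin n} {I : Finset (Fin n)} (hij : i ≠ j) (hi : i ∈ I)
    (hj : j ∈ I) :
    koszulSign k i I * koszulSign k j (I.erase i) + koszulSign k j I * koszulSign k i (I.erase j)
      = 0 := by
  rcases lt_or_gt_of_ne hij with h | h
  · rw [koszulSign_erase_of_lt hi h, koszulSign_erase_of_le h.le]
    ring
  · rw [koszulSign_erase_of_lt hj h, koszulSign_erase_of_le h.le]
    ring

theorem koszulSign_mul_insert_add {m j : Fin n} {I : Finset (Fin n)} (hm : m ∉ I) (hj : j ∈ I) :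
    koszulSign k m I * koszulSign k j (insert m I) + koszulSign k m (I.erase j) * koszulSign k j I
      = 0 := by
  rcases lt_or_gt_of_ne (ne_of_mem_of_not_mem hj hm) with h | h
  · have hins := koszulSign_erase_of_le (k := k) (I := insert m I) h.le
    rw [Finset.erase_insert hm] at hins
    rw [koszulSign_erase_of_lt hj h, hins]
    ring
  · have hins := koszulSign_erase_of_lt (k := k) (Finset.mem_insert_self m I) h
    rw [Finset.erase_insert hm] at hins
    rw [koszulSign_erase_of_le h.le, hins]
    ring

variable (k n) in
/-- The Koszul complex of the elements `X_j ⊗ 1 - 1 ⊗ X_j`: the set `I` stands for the exterior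
monomial `e_I`. -/
def koszulComplex :
    LoweringComplex (Env k (MvPolynomial (Fin n) k)) (Fin n) (Finset (Fin n)) where
  deg := finsetDeg
  lower I j := I.erase j
  coeff _ I j := koszulSign k j I • envDiff k (X j)
  deg_lower h := finsetDeg_erase (finsetDeg_ne_zero_iff.1 h)
  lower_comm _ _ _ := Finset.erase_right_comm
  coeff_mul_self _ I j h := absurd (finsetDeg_ne_zero_iff.1 h) (Finset.notMem_erase j I)
  coeff_mul_add _ I i j hij hi hj := by
    rw [finsetDeg_ne_zero_iff] at hi hj
    rw [smul_mul_smul_comm, smul_mul_smul_comm, envDiff_mul_comm (X j), ← add_smul,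
      koszulSign_mul_erase_add hij hi hj, zero_smul]

variable (k n) in
/-- The partial homotopies `r e_I ↦ (Δ_m r) e_m e_I`, where `Δ_m` is the divided difference. -/
def koszulHomotopies : (koszulComplex k n).PartialHomotopies k where
  raise I m := insert m I
  op I m := if m ∈ I then 0 else koszulSign k m I • dividedDifference k m
  deg_raise {I m} h := by
    rw [ite_ne_left_iff] at h
    exact (finsetDeg_insert h.1).trans (add_comm _ _)
  lower_raise_self {I m} h := by
    rw [ite_ne_left_iff] at h
    exact Finset.erase_insert h.1
  lower_raise_of_ne _ _ _ hj := Finset.erase_insert_of_ne hj.symm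
  raise_lower h := Finset.insert_erase (finsetDeg_ne_zero_iff.1 h)
  op_mul_self _ I m r h := by
    have hm : m ∈ I := finsetDeg_ne_zero_iff.1 h
    change _ + (if m ∈ I.erase m then 0 else koszulSign k m (I.erase m) • dividedDifference k m)
      (r * koszulSign k m I • envDiff k (X m)) = r
    rw [if_pos hm, if_neg (Finset.notMem_erase m I), LinearMap.zero_apply, zero_mul, zero_add,
      LinearMap.smul_apply, mul_smul_comm, map_smul, dividedDifference_mul_self,
      koszulSign_erase_of_le le_rfl, smul_smul, koszulSign_mul_self, one_smul]
  op_mul_of_ne _ I m j r hjm h := by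
    have hj : j ∈ I := finsetDeg_ne_zero_iff.1 h
    change _ * koszulSign k j (insert m I) • envDiff k (X j)
      + (if m ∈ I.erase j then 0 else koszulSign k m (I.erase j) • dividedDifference k m)
        (r * koszulSign k j I • envDiff k (X j)) = 0
    by_cases hm : m ∈ I
    · simp [hm, hjm.symm]
    · rw [if_neg hm, if_neg fun h => hm (Finset.mem_of_mem_erase h), LinearMap.smul_apply,
        LinearMap.smul_apply, smul_mul_smul_comm, mul_smul_comm, map_smul,
        dividedDifference_mul_of_ne hjm, smul_smul, ← add_smul,
        koszulSign_mul_insert_add hm hj, zero_smul]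

instance : Unique ((koszulComplex k n).Basis 0) where
  default := ⟨∅, map_zero _⟩
  uniq I := Subtype.ext (finsetDeg_injective ((Finsupp.degree_eq_zero_iff _).1 I.2))

theorem koszulComplex_coeff_zero {I : Finset (Fin n)} {j : Fin n}
    (hI : finsetDeg I = Finsupp.single j 1) :
    (koszulComplex k n).coeff 0 I j = envDiff k (X j) := by
  obtain rfl : I = {j} := finsetDeg_injective (hI.trans (finsetDeg_singleton j).symm)
  change koszulSign k j {j} • _ = _
  rw [koszulSign_singleton, one_smul]

theorem koszul_isMultigradedFreeResolution :
    IsMultigradedFreeResolution (envPiece (X : Fin n → MvPolynomial (Fin n) k))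
      (algPiece (X : Fin n → MvPolynomial (Fin n) k))
      (fun i (I : (koszulComplex k n).Basis i) => finsetDeg I.1) (koszulComplex k n).d
      (Finsupp.linearCombination _ fun _ => (1 : MvPolynomial (Fin n) k)) :=
  LoweringComplex.isMultigradedFreeResolution (koszulHomotopies k n)
    isHomogeneousBasis_basisMonomials.iSup_eq_top (fun j => ⟨{j}, finsetDeg_singleton j⟩)
    (fun _ _ => koszulComplex_coeff_zero)
    fun _ _ j => Submodule.smul_mem _ _ (envDiff_generator_mem_envPiece j)

end Koszul

/-! ### Hilbert series -/

section Hilbert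

open MvPolynomial

theorem card_subtype_degree {J σ : Type*} (deg : J → σ →₀ ℕ) (i : ℕ) (α : σ →₀ ℕ) :
    ENat.card {b : {j // (deg j).degree = i} // deg b.1 = α}
      = if i = α.degree then ENat.card {j // deg j = α} else 0 := by
  split_ifs with hi
  · exact ENat.card_congr (Equiv.subtypeSubtypeEquivSubtype fun {j} (hj : deg j = α) => by
      rw [hj, hi])
  · rw [ENat.card_eq_zero_iff_empty]
    exact ⟨fun b => hi (by rw [← b.2, b.1.2])⟩

variable {k : Type*} [Field k] {σ : Type*} {A A' : Type*} [Ring A] [Algebra k A] [Ring A']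
  [Algebra k A'] {x : σ → A} {y : σ → A'} {I J : Type*} {v : Module.Basis I k A}
  {w : Module.Basis J k A'} {degA : I → σ →₀ ℕ} {deg : J → σ →₀ ℕ} {ε : A →ₐ[k] k}

/-- Homological and internal degree agree on the generators, so the resolution is minimal and its
generators, which span `Tor`, are counted by the homogeneous basis `w` of the dual algebra. -/
theorem hilbHH_eq_hilbAlg (hv : IsHomogeneousBasis (algPiece (k := k) x) v degA)
    (hw : IsHomogeneousBasis (algPiece (k := k) y) w deg) (hε : ∀ s, ε (x s) = 0)
    {d : ∀ i, ({j // (deg j).degree = i + 1} →₀ Env k A) →ₗ[Env k A]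
      ({j // (deg j).degree = i} →₀ Env k A)}
    {aug : ({j // (deg j).degree = 0} →₀ Env k A) →ₗ[Env k A] A}
    (hP : IsMultigradedFreeResolution (envPiece (k := k) x) (algPiece (k := k) x)
      (fun i (j : {j // (deg j).degree = i}) => deg j.1) d aug) :
    hilbHH ε x = hilbAlg k y := by
  have hε' := envAug_eq_zero_of_mem_envPiece hε
  funext m
  rw [hilbHH_eq_hilbTor hv ε hP, hilbTor_of_isMinimal hε' _ (hP.isMinimal hε' fun _ j => j.2),
    card_subtype_degree, hilbAlg, hw.dimK_eq]

variable {n : ℕ}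

theorem hilbHH_extAlg :
    hilbHH (ExtAlg.aug k n) (ExtAlg.x k n) = hilbAlg k (X : Fin n → MvPolynomial (Fin n) k) :=
  hilbHH_eq_hilbAlg ExtAlg.isHomogeneousBasis_basis isHomogeneousBasis_basisMonomials ExtAlg.aug_x
    cartan_isMultigradedFreeResolution

theorem hilbHH_poly :
    hilbHH (polyAug k n) (X : Fin n → MvPolynomial (Fin n) k) = hilbAlg k (ExtAlg.x k n) :=
  hilbHH_eq_hilbAlg isHomogeneousBasis_basisMonomials ExtAlg.isHomogeneousBasis_basis polyAug_X
    koszul_isMultigradedFreeResolution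

end Hilbert

end HochschildDuality

end

/-- Let `E` be the exterior algebra on `n` generators over a field `k` and `S` the polynomial ring
in `n` variables. The divided power complex is a (multigraded) minimal free resolution of `E` over
`E ⊗ Eᵒᵖ`; the Hilbert series of `HH(E, k)` is the one of `Tor^{E ⊗ Eᵒᵖ}(k, E)` (computed by an
arbitrary multigraded free resolution of `E`); and `Hilb HH(E, k) = Hilb S`,
`Hilb HH(S, k) = Hilb E`. -/
theorem theorem5p3 {k : Type*} [Field k] (n : ℕ) :
    (IsMultigradedFreeResolution (N := ExtAlg k n) (envPiece (ExtAlg.x k n))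
        (algPiece (ExtAlg.x k n)) (B := CartanBasis n) (fun _ l => l.1) (cartanD k n)
        (cartanAug k n) ∧
      IsMinimal (envAug (ExtAlg.aug k n)) (cartanD k n)) ∧
    (∀ (B : ℕ → Type*) (deg : ∀ i, B i → Fin n →₀ ℕ)
        (d : ∀ i, (B (i + 1) →₀ Env k (ExtAlg k n)) →ₗ[Env k (ExtAlg k n)]
          (B i →₀ Env k (ExtAlg k n)))
        (aug : (B 0 →₀ Env k (ExtAlg k n)) →ₗ[Env k (ExtAlg k n)] ExtAlg k n),
      IsMultigradedFreeResolution (envPiece (ExtAlg.x k n)) (algPiece (ExtAlg.x k n)) deg d aug →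
        hilbHH (ExtAlg.aug k n) (ExtAlg.x k n)
          = hilbTor (envAug (ExtAlg.aug k n)) (envPiece (ExtAlg.x k n)) deg d) ∧
    hilbHH (ExtAlg.aug k n) (ExtAlg.x k n) =
      hilbAlg k (MvPolynomial.X : Fin n → MvPolynomial (Fin n) k) ∧
    hilbHH (polyAug k n) (MvPolynomial.X : Fin n → MvPolynomial (Fin n) k)
      = hilbAlg k (ExtAlg.x k n) := by
  exact ⟨⟨cartan_isMultigradedFreeResolution, cartan_isMinimal⟩, fun B deg d aug h =>
    hilbHH_eq_hilbTor ExtAlg.isHomogeneousBasis_basis _ h, hilbHH_extAlg, hilbHH_poly⟩
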